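/- Let $P$ be an irreducible transition probability on a countably infinite state space $S$, and let $(X_n)_{n\ge 0}$ be the Markov chain with transition probability $P$, started at $x$ under $\mathbb P^x$. For $x,y\in S$ put $G(x,y|z)=\sum_{n\ge0}\mathbb P^x(X_n=y)z^n$ and $U(x,y|z)=\sum_{n\ge0}\mathbb P^x(\tau^y=n)z^n$, where $\tau^y=\inf\{n\ge1:X_n=y\}$. The radius of convergence of $G(x,y|\cdot)$ does not depend on $x,y$; its reciprocal $\rho=\rho(P)$ is the spectral radius of $P$. Let $r(U|x,x)$ be the radius of convergence of $U(x,x|\cdot)$. Call $P$ rho-recurrent (respectively rho-transient) if $G(x,y|1/\rho)=\infty$ (respectively $<\infty$) for all $x,y\in S$. A rho-recurrent $P$ is critically rho-recurrent if $r(U|x,x)=1/\rho$ for every $x\in S$, and strictly rho-recurrent otherwise. For $L\subset S$ and $\kappa\in[0,1)$ the $(L,\kappa)$-lazy version $P^L_\kappa$ of $P$ is given by $P^L_\kappa(x,y)=\kappa 1_{\{x=y\}}+(1-\kappa)P(x,y)$ if $x\in L$ and $P^L_\kappa(x,y)=P(x,y)$ if $x\notin L$. It is again an irreducible transition probability; write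 $\rho^L_\kappa$ for its spectral radius, and apply the above classification to $P^L_\kappa$ with its own spectral radius $\rho^L_\kappa$. **Theorem.** Suppose that $\rho<1$ and that $L$ is finite and nonempty. (i) Suppose that $P$ is rho-transient. Then there is a unique $\kappa_c(L)\in(0,1)$ such that - for every $\kappa\in[0,\kappa_c(L))$, $\rho^L_\kappa=\rho$ and $P^L_\kappa$ is rho-transient; - on $[\kappa_c(L),1)$ the function $\kappa\mapsto\rho^L_\kappa$ is strictly increasing, $\rho^L_{\kappa_c(L)}=\rho$, and $P^L_\kappa$ is rho-recurrent for every $\kappa\in[\kappa_c(L),1)$. Moreover, $P^L_{\kappa_c(L)}$ is critically rho-recurrent, and $P^L_\kappa$ is strictly rho-recurrent for every $\kappa\in(\kappa_c(L),1)$. (ii) If $P$ is rho-recurrent, then $P^L_\kappa$ is strictly rho-recurrent for every $\kappa\in(0,1)$. -/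

import Mathlib

open scoped ENNReal
open Set

noncomputable section

namespace LazyChain

variable {S : Type*}

/-- `P` is a transition probability (a stochastic matrix) on the state space `S`. -/
structure IsTransitionProb (P : S → S → ℝ) : Prop where
  nonneg : ∀ x y, 0 ≤ P x y
  hasSum_one : ∀ x, HasSum (P x) 1

open scoped Classical in
/-- `ℙˣ((X₀, …, Xₙ) ∈ A)` for the Markov chain `(Xₙ)` with transition probability `P` started
at `x`: the sum, over the trajectories `w = (w₀, …, wₙ) ∈ A` with `w₀ = x`, of the probability
`∏ P(wᵢ, wᵢ₊₁)` that the chain follows `w`. -/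
def pathProb (P : S → S → ℝ) (x : S) (n : ℕ) (A : Set (Fin (n + 1) → S)) : ℝ≥0∞ :=
  ∑' w : Fin (n + 1) → S,
    if w 0 = x ∧ w ∈ A then ENNReal.ofReal (∏ i : Fin n, P (w i.castSucc) (w i.succ)) else 0

/-- `ℙˣ(Xₙ = y)`. -/
def stepProb (P : S → S → ℝ) (x y : S) (n : ℕ) : ℝ≥0∞ :=
  pathProb P x n {w | w (Fin.last n) = y}

/-- `ℙˣ(τʸ = n)`, where `τʸ = inf {k ≥ 1 : X_k = y}`: the event says that `n` is the least
`k ≥ 1` with `X_k = y`. -/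
def firstHitProb (P : S → S → ℝ) (x y : S) (n : ℕ) : ℝ≥0∞ :=
  pathProb P x n {w | IsLeast {k : Fin (n + 1) | 1 ≤ (k : ℕ) ∧ w k = y} (Fin.last n)}

/-- Irreducibility: every state can be reached from every state. -/
def IsIrreducible (P : S → S → ℝ) : Prop :=
  ∀ x y, ∃ n, 0 < stepProb P x y n

/-- The radius of convergence of the power series `∑ aₙ zⁿ`, for finite coefficients `aₙ ≥ 0`
(they are probabilities wherever this is used). -/
def convRadius (a : ℕ → ℝ≥0∞) : ℝ≥0∞ :=
  (FormalMultilinearSeries.ofScalars ℝ (fun n => (a n).toReal)).radius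

/-- The Green function `G(x, y | z) = ∑ₙ ℙˣ(Xₙ = y) zⁿ`, for `z ≥ 0`. -/
def green (P : S → S → ℝ) (x y : S) (z : ℝ≥0∞) : ℝ≥0∞ :=
  ∑' n, stepProb P x y n * z ^ n

/-- The spectral radius: the reciprocal of the radius of convergence of `G(x, y | ·)`, which does
not depend on `x, y` when `P` is irreducible; the supremum selects that common value. -/
def spectralRadius (P : S → S → ℝ) : ℝ≥0∞ :=
  ⨆ (x : S) (y : S), (convRadius (stepProb P x y))⁻¹

/-- The radius of convergence `r(U | x, y)` of the U-function `∑ₙ ℙˣ(τʸ = n) zⁿ`. -/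
def radiusU (P : S → S → ℝ) (x y : S) : ℝ≥0∞ :=
  convRadius (firstHitProb P x y)

def IsRhoRecurrent (P : S → S → ℝ) : Prop :=
  ∀ x y, green P x y (spectralRadius P)⁻¹ = ∞

def IsRhoTransient (P : S → S → ℝ) : Prop :=
  ∀ x y, green P x y (spectralRadius P)⁻¹ < ∞

def IsCriticallyRhoRecurrent (P : S → S → ℝ) : Prop :=
  IsRhoRecurrent P ∧ ∀ x, radiusU P x x = (spectralRadius P)⁻¹

def IsStrictlyRhoRecurrent (P : S → S → ℝ) : Prop :=
  IsRhoRecurrent P ∧ ¬ ∀ x, radiusU P x x = (spectralRadius P)⁻¹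

open scoped Classical in
/-- The `(L, κ)`-lazy version of `P`. -/
def lazy (P : S → S → ℝ) (L : Set S) (κ : ℝ) (x y : S) : ℝ :=
  if x ∈ L then
    if x = y then κ + (1 - κ) * P x x else (1 - κ) * P x y
  else P x y

/-- `κc` is the critical laziness `κ_c(L)` of `P`: the point of `(0, 1)` below which the
spectral radius of the lazy version stays at that of `P` and the lazy version is rho-transient,
and from which on the spectral radius is strictly increasing (starting from that of `P`) and the
lazy version is rho-recurrent. -/
structure IsCriticalValue (P : S → S → ℝ) (L : Set S) (κc : ℝ) : Prop where
  mem : κc ∈ Ioo (0 : ℝ) 1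
  below : ∀ κ ∈ Ico 0 κc,
    spectralRadius (lazy P L κ) = spectralRadius P ∧ IsRhoTransient (lazy P L κ)
  strictMono : StrictMonoOn (fun κ => spectralRadius (lazy P L κ)) (Ico κc 1)
  at_critical : spectralRadius (lazy P L κc) = spectralRadius P
  above : ∀ κ ∈ Ico κc 1, IsRhoRecurrent (lazy P L κ)

end LazyChain

end

/-! Everything is computed with matrices over `[0, ∞]`, where all sums exist: the Green function at
z is the Neumann series `star` of the matrix zP. Summing over holding times (`star_lazyMat`) shows
that laziness κ on L acts, up to a factor 1/(1 - zκ) at the final state, by multiplying the steps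
out of L by t = (1-κ)/(1-zκ) (`boost`). Cutting paths at their visits to L (`star_weighted`) then
reduces finiteness of the Green function on L × L to that of the Neumann series of t V(z), where
V(z) is the matrix of first-return series to L.

As L is finite, this finiteness survives multiplication of the entries of t V(z) by some c > 1
(`exists_forall_star_weighted_ne_top`). Moreover V is continuous up to any radius where it is
finite, while t increases strictly in κ for z > 1 and, for κ > 0, strictly in z as long as zκ < 1.
Write R = 1/ρ > 1. Three consequences carry the theorem.

If the lazy Green function has radius r < R, it is infinite at r, since finiteness would propagate
beyond r. The same argument for the chain killed at a point x of L pushes the first-return series at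
x beyond r, so the recurrence is strict.

If the Green function with laziness κ is infinite at its radius r, every larger laziness has a
smaller radius: otherwise the strict gain in t would pay for moving from r to a slightly smaller z,
and the first Green function would be finite at r (`star_lazyMat_ne_top_of_lt`). With κ = 0 this
gives (ii).

If P is transient, κ_c is the supremum of the κ with finite Green function at R. Openness makes it
positive and not attained, and the necessary condition Rκ < 1 keeps it below 1. For z < R the strict
increase of t in z keeps the Green function at κ_c finite, so the spectral radius there is still ρ.
Recurrence is critical because the first-return series of P diverges beyond R, and laziness cannot
remove that divergence. -/

noncomputable section

/-! ### Matrices over [0, ∞] and their Neumann series -/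

namespace LazyChain

/-- Matrices with entries in `[0, ∞]` over an arbitrary index set. -/
def InfMat (S : Type*) := S → S → ℝ≥0∞

namespace InfMat

variable {S : Type*}

instance : AddCommMonoid (InfMat S) := inferInstanceAs (AddCommMonoid (S → S → ℝ≥0∞))
instance : PartialOrder (InfMat S) := inferInstanceAs (PartialOrder (S → S → ℝ≥0∞))

open scoped Classical in
instance : One (InfMat S) := ⟨fun x y => if x = y then 1 else 0⟩

instance : Mul (InfMat S) := ⟨fun A B x y => ∑' s, A x s * B s y⟩

@[ext] theorem ext {A B : InfMat S} (h : ∀ x y, A x y = B x y) : A = B :=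
  funext fun x => funext fun y => h x y

open scoped Classical in
theorem one_apply (x y : S) : (1 : InfMat S) x y = if x = y then 1 else 0 := rfl

@[simp] theorem one_apply_self (x : S) : (1 : InfMat S) x x = 1 := by simp [one_apply]

theorem one_apply_ne {x y : S} (h : x ≠ y) : (1 : InfMat S) x y = 0 := by simp [one_apply, h]

theorem mul_apply (A B : InfMat S) (x y : S) : (A * B) x y = ∑' s, A x s * B s y := rfl

@[simp] theorem add_apply (A B : InfMat S) (x y : S) : (A + B) x y = A x y + B x y := rfl

@[simp] theorem zero_apply (x y : S) : (0 : InfMat S) x y = 0 := rfl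

instance : Semiring (InfMat S) where
  left_distrib A B C := by
    ext x y; simp only [mul_apply, add_apply, mul_add, ENNReal.tsum_add]
  right_distrib A B C := by
    ext x y; simp only [mul_apply, add_apply, add_mul, ENNReal.tsum_add]
  zero_mul A := by ext x y; simp [mul_apply]
  mul_zero A := by ext x y; simp [mul_apply]
  mul_assoc A B C := by
    ext x y
    simp only [mul_apply, ← ENNReal.tsum_mul_right, ← ENNReal.tsum_mul_left]
    rw [ENNReal.tsum_comm]
    simp only [mul_assoc]
  one_mul A := by
    ext x y
    rw [mul_apply, tsum_eq_single x]
    · simp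
    · intro s hs; rw [one_apply_ne hs.symm, zero_mul]
  mul_one A := by
    ext x y
    rw [mul_apply, tsum_eq_single y]
    · simp
    · intro s hs; rw [one_apply_ne hs, mul_zero]

theorem mul_le_mul'' {A B C D : InfMat S} (h : A ≤ B) (h' : C ≤ D) : A * C ≤ B * D :=
  fun x y => ENNReal.tsum_le_tsum fun s => mul_le_mul' (h x s) (h' s y)

theorem add_le_add'' {A B C D : InfMat S} (h : A ≤ B) (h' : C ≤ D) : A + C ≤ B + D :=
  fun x y => add_le_add (h x y) (h' x y)

theorem le_add_left'' (A B : InfMat S) : A ≤ B + A := fun _ _ => le_add_self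

theorem le_add_right'' (A B : InfMat S) : A ≤ A + B := fun _ _ => le_self_add

theorem pow_mono {A B : InfMat S} (h : A ≤ B) (n : ℕ) : A ^ n ≤ B ^ n := by
  induction n with
  | zero => simp
  | succ n ih => rw [pow_succ, pow_succ]; exact mul_le_mul'' ih h

theorem mul_apply_le (A B : InfMat S) (x s y : S) : A x s * B s y ≤ (A * B) x y :=
  ENNReal.le_tsum (f := fun s => A x s * B s y) s

theorem exists_of_mul_apply_ne_zero {A B : InfMat S} {x y : S} (h : (A * B) x y ≠ 0) :
    ∃ s, A x s ≠ 0 ∧ B s y ≠ 0 := by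
  by_contra! hc
  refine h (ENNReal.tsum_eq_zero.2 fun s => ?_)
  by_cases h' : A x s = 0
  · simp [h']
  · simp [hc s h']

/-- The Neumann series `∑ₖ Aᵏ`. -/
def star (A : InfMat S) : InfMat S := fun x y => ∑' k, (A ^ k) x y

theorem star_apply (A : InfMat S) (x y : S) : star A x y = ∑' k, (A ^ k) x y := rfl

theorem mul_star (A : InfMat S) (B : InfMat S) (x y : S) :
    (B * star A) x y = ∑' k, (B * A ^ k) x y := by
  simp only [mul_apply, star_apply, ← ENNReal.tsum_mul_left]
  rw [ENNReal.tsum_comm]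

theorem star_mul (A : InfMat S) (B : InfMat S) (x y : S) :
    (star A * B) x y = ∑' k, (A ^ k * B) x y := by
  simp only [mul_apply, star_apply, ← ENNReal.tsum_mul_right]
  rw [ENNReal.tsum_comm]

theorem star_eq_one_add_mul (A : InfMat S) : star A = 1 + A * star A := by
  ext x y
  rw [add_apply, mul_star, star_apply, tsum_eq_zero_add' ENNReal.summable, pow_zero]
  simp only [pow_succ']

theorem star_eq_one_add_mul' (A : InfMat S) : star A = 1 + star A * A := by
  ext x y
  rw [add_apply, star_mul, star_apply, tsum_eq_zero_add' ENNReal.summable, pow_zero]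
  simp only [pow_succ]

/-- Iterating the hypothesis bounds every partial sum by X. This minimality replaces subtraction,
which is unavailable for infinite entries, and is the source of all upper bounds on Neumann series.
-/
theorem star_mul_le {A B X : InfMat S} (h : B + A * X ≤ X) : star A * B ≤ X := by
  intro x y
  rw [star_mul]
  refine ENNReal.tsum_le_of_sum_range_le fun n => ?_
  suffices H : ∀ n x, ∑ k ∈ Finset.range n, (A ^ k * B) x y ≤ X x y from H n x
  intro n
  induction n with
  | zero => simp
  | succ n ih =>
    intro x
    rw [Finset.sum_range_succ']
    refine le_trans ?_ (h x y)
    rw [add_comm, add_apply, pow_zero, one_mul]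
    gcongr
    calc ∑ k ∈ Finset.range n, (A ^ (k + 1) * B) x y
        = ∑ k ∈ Finset.range n, ∑' s, A x s * (A ^ k * B) s y := by
          simp only [pow_succ', mul_assoc]; rfl
      _ = ∑' s, A x s * ∑ k ∈ Finset.range n, (A ^ k * B) s y := by
          simp only [Finset.mul_sum]
          rw [Summable.tsum_finsetSum fun _ _ => ENNReal.summable]
      _ ≤ ∑' s, A x s * X s y := ENNReal.tsum_le_tsum fun s => by gcongr; exact ih s

theorem star_le {A X : InfMat S} (h : 1 + A * X ≤ X) : star A ≤ X := by
  simpa using star_mul_le h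

theorem one_le_star (A : InfMat S) : 1 ≤ star A := by
  rw [star_eq_one_add_mul]; exact le_add_right'' _ _

theorem pow_le_star (A : InfMat S) (n : ℕ) : A ^ n ≤ star A :=
  fun x y => ENNReal.le_tsum (f := fun k => (A ^ k) x y) n

theorem star_mono {A B : InfMat S} (h : A ≤ B) : star A ≤ star B :=
  fun x y => ENNReal.tsum_le_tsum fun n => pow_mono h n x y

theorem mul_star_le_star (A : InfMat S) : A * star A ≤ star A := by
  conv_rhs => rw [star_eq_one_add_mul]
  exact le_add_left'' _ _

theorem star_mul_pow_le (A : InfMat S) (n : ℕ) : star A * A ^ n ≤ star A := by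
  induction n with
  | zero => simp
  | succ n ih =>
    rw [pow_succ, ← mul_assoc]
    refine (mul_le_mul'' ih le_rfl).trans ?_
    conv_rhs => rw [star_eq_one_add_mul']
    exact le_add_left'' _ _

theorem pow_mul_star_le (A : InfMat S) (n : ℕ) : A ^ n * star A ≤ star A := by
  induction n with
  | zero => simp
  | succ n ih =>
    rw [pow_succ, mul_assoc]
    exact (mul_le_mul'' le_rfl (mul_star_le_star A)).trans ih

/-- A path with steps of two kinds is a run of A-steps followed by blocks, each a B-step and then a
run of A-steps. Each inequality verifies a supersolution. -/
theorem star_add (A B : InfMat S) : star (A + B) = star A * star (B * star A) := by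
  apply le_antisymm
  · apply star_le
    have h1 := star_eq_one_add_mul (B * star A)
    set Z := star (B * star A)
    have h2 : star A * Z = Z + A * (star A * Z) := by
      conv_lhs => rw [star_eq_one_add_mul A, add_mul, one_mul, mul_assoc]
    have h3 : star A * Z = 1 + B * star A * Z + A * (star A * Z) := by rw [← h1]; exact h2
    conv_rhs => rw [h3]
    rw [add_mul, ← mul_assoc B, add_assoc, add_comm (A * _)]
  · have hX := star_eq_one_add_mul (A + B)
    set X := star (A + B)
    have h1 : star A * (1 + B * X) ≤ X := by
      apply star_mul_le
      conv_rhs => rw [hX, add_mul, add_comm (A * X), ← add_assoc]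
    have h2 : star (B * star A) ≤ 1 + B * X := by
      apply star_le
      rw [mul_assoc]
      exact add_le_add'' le_rfl (mul_le_mul'' le_rfl h1)
    exact (mul_le_mul'' le_rfl h2).trans h1

theorem star_add' (C D : InfMat S) : star (C + D) = star (star C * D) * star C := by
  apply le_antisymm
  · apply star_le
    have h1 := star_eq_one_add_mul (star C * D)
    set Y := star (star C * D) * star C with hY
    have h2 : Y = star C * (1 + D * Y) := by
      conv_lhs => rw [hY, h1, add_mul, one_mul, mul_assoc, mul_assoc, ← mul_assoc D, mul_assoc D]
      rw [mul_add, mul_one]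
    have h3 : Y = (1 + D * Y) + C * Y := by
      conv_lhs => rw [h2, star_eq_one_add_mul C, add_mul, one_mul, mul_assoc, ← h2]
    conv_rhs => rw [h3]
    rw [add_mul, add_assoc, add_comm (C * Y)]
  · apply star_mul_le
    have hX := star_eq_one_add_mul (C + D)
    set X := star (C + D)
    have : star C * (1 + D * X) ≤ X := by
      apply star_mul_le
      conv_rhs => rw [hX, add_mul, add_comm (C * X), ← add_assoc]
    rwa [mul_add, mul_one, ← mul_assoc] at this

theorem exists_pow_ne_zero {A : InfMat S} {x y : S} (h : star A x y ≠ 0) :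
    ∃ n, (A ^ n) x y ≠ 0 := by
  by_contra! hc
  exact h (ENNReal.tsum_eq_zero.2 hc)

theorem star_ne_top_of_star_ne_top {A : InfMat S} {x y u v : S} (h : star A x y ≠ ∞)
    (hu : star A x u ≠ 0) (hv : star A v y ≠ 0) : star A u v ≠ ∞ := by
  obtain ⟨m, hm⟩ := exists_pow_ne_zero hu
  obtain ⟨n, hn⟩ := exists_pow_ne_zero hv
  intro ht
  apply h
  rw [eq_top_iff]
  calc ∞ = (A ^ m) x u * (star A u v * (A ^ n) v y) := by
        rw [ht, ENNReal.top_mul hn, ENNReal.mul_top hm]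
    _ ≤ (A ^ m) x u * star A u y := by
        gcongr
        exact (mul_apply_le _ _ _ _ _).trans (star_mul_pow_le A n u y)
    _ ≤ star A x y := (mul_apply_le _ _ _ _ _).trans (pow_mul_star_le A m x y)

theorem pow_apply_self_le (A : InfMat S) (x : S) (n : ℕ) : (A x x) ^ n ≤ (A ^ n) x x := by
  induction n with
  | zero => simp
  | succ n ih =>
    rw [pow_succ, pow_succ]
    exact (mul_le_mul' ih le_rfl).trans (mul_apply_le _ _ _ _ _)

/-- Loops of length n with total weight at least 1 could be repeated, giving infinitely many terms
at least 1. -/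
theorem star_ne_top_of_pow {A : InfMat S} {x : S} (h : star A x x ≠ ∞) {n : ℕ} (hn : 0 < n) :
    (A ^ n) x x < 1 := by
  by_contra! hc
  apply h
  rw [eq_top_iff]
  calc ∞ = ∑' _ : ℕ, (1 : ℝ≥0∞) := by simp
    _ ≤ ∑' k : ℕ, (A ^ (n * k)) x x := ENNReal.tsum_le_tsum fun k => by
        rw [pow_mul]
        exact (one_le_pow₀ hc).trans (pow_apply_self_le _ _ _)
    _ ≤ star A x x :=
        ENNReal.tsum_comp_le_tsum_of_injective
          (fun a b hab => Nat.eq_of_mul_eq_mul_left hn hab) (fun k => (A ^ k) x x)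

/-- `A` with its rows multiplied by the weights `a`. -/
def row (a : S → ℝ≥0∞) (A : InfMat S) : InfMat S := fun x y => a x * A x y

theorem row_apply (a : S → ℝ≥0∞) (A : InfMat S) (x y : S) : row a A x y = a x * A x y := rfl

theorem row_mul (a : S → ℝ≥0∞) (A B : InfMat S) : row a A * B = row a (A * B) := by
  ext x y; simp only [mul_apply, row_apply, mul_assoc, ENNReal.tsum_mul_left]

theorem row_row (a b : S → ℝ≥0∞) (A : InfMat S) : row a (row b A) = row (fun x => a x * b x) A := by
  ext x y; simp only [row_apply, mul_assoc]

theorem mul_row_const (z : ℝ≥0∞) (A B : InfMat S) :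
    A * row (fun _ => z) B = row (fun _ => z) (A * B) := by
  ext x y; simp only [mul_apply, row_apply, ← ENNReal.tsum_mul_left, mul_left_comm]

theorem row_const_pow (z : ℝ≥0∞) (A : InfMat S) (n : ℕ) :
    row (fun _ => z) A ^ n = row (fun _ => z ^ n) (A ^ n) := by
  induction n with
  | zero => ext; simp [row_apply]
  | succ n ih => rw [pow_succ, ih, mul_row_const, row_mul, row_row, ← pow_succ]; simp only [← pow_succ']

theorem row_mono {a b : S → ℝ≥0∞} {A B : InfMat S} (h : ∀ x, a x ≤ b x) (h' : A ≤ B) :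
    row a A ≤ row b B := fun x y => mul_le_mul' (h x) (h' x y)

theorem star_row_one (a : S → ℝ≥0∞) : star (row a 1) = row (fun x => (1 - a x)⁻¹) 1 := by
  have h : ∀ k, (row a 1) ^ k = row (fun x => a x ^ k) 1 := by
    intro k
    induction k with
    | zero => ext; simp [row_apply]
    | succ k ih => rw [pow_succ, ih, row_mul, one_mul, row_row]; simp only [pow_succ]
  ext x y
  simp only [star_apply, h, row_apply, ENNReal.tsum_mul_right, ENNReal.tsum_geometric]

theorem mul_row_one (a : S → ℝ≥0∞) (A : InfMat S) (x y : S) :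
    (A * row a 1) x y = A x y * a y := by
  rw [mul_apply, tsum_eq_single y]
  · simp [row_apply]
  · intro s hs; rw [row_apply, one_apply_ne hs, mul_zero, mul_zero]

theorem star_apply_of_row_eq_zero {A : InfMat S} {x : S} (h : ∀ y, A x y = 0) (y : S) :
    star A x y = (1 : InfMat S) x y := by
  conv_lhs => rw [star_eq_one_add_mul]
  simp [mul_apply, h]

theorem mul_apply_of_row_eq {A B : InfMat S} {x : S} (h : ∀ y, A x y = (1 : InfMat S) x y) (y : S) :
    (A * B) x y = B x y := by
  conv_rhs => rw [← one_mul B]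
  simp only [mul_apply, h]

end InfMat

/-! ### Power series with nonnegative coefficients, and the effective weight of laziness -/

section

open Filter Topology

/-- Weierstrass test, dominated by the terms at z₀; the endpoint is included, which matters at the
radius of convergence. -/
theorem continuousOn_powerSeries {a : ℕ → ℝ≥0∞} {z₀ : ℝ≥0∞} (h0 : z₀ ≠ 0)
    (h : ∑' n, a n * z₀ ^ n ≠ ∞) : ContinuousOn (fun z : ℝ≥0∞ => ∑' n, a n * z ^ n) (Iic z₀) := by
  have hle : ∀ n, ∀ z ∈ Iic z₀, a n * z ^ n ≤ a n * z₀ ^ n := fun n z hz => by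
    gcongr; exact hz
  have hfin : ∀ n, a n * z₀ ^ n ≠ ∞ := ENNReal.ne_top_of_tsum_ne_top h
  have ha : ∀ n, a n ≠ ∞ := fun n hn => hfin n (by
    rw [hn, ENNReal.top_mul (pow_ne_zero _ h0)])
  have hc : ContinuousOn (fun z : ℝ≥0∞ => ∑' n, (a n * z ^ n).toReal) (Iic z₀) := by
    refine continuousOn_tsum (u := fun n => (a n * z₀ ^ n).toReal) (fun n z hz => ?_)
      (ENNReal.summable_toReal h) (fun n z hz => ?_)
    · have h1 : ContinuousAt (fun z : ℝ≥0∞ => a n * z ^ n) z :=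
        ((ENNReal.continuous_const_mul (ha n)).comp (ENNReal.continuous_pow n)).continuousAt
      have h2 : ContinuousAt (fun z : ℝ≥0∞ => (a n * z ^ n).toReal) z :=
        (ENNReal.tendsto_toReal (ne_top_of_le_ne_top (hfin n) (hle n z hz))).comp h1
      exact h2.continuousWithinAt
    · rw [Real.norm_of_nonneg ENNReal.toReal_nonneg]
      exact ENNReal.toReal_mono (hfin n) (hle n z hz)
  refine (ENNReal.continuous_ofReal.comp_continuousOn hc).congr fun z hz => ?_
  have hz' : ∑' n, a n * z ^ n ≠ ∞ :=
    ne_top_of_le_ne_top h (ENNReal.tsum_le_tsum fun n => hle n z hz)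
  simp only [Function.comp]
  rw [← ENNReal.tsum_toReal_eq (ENNReal.ne_top_of_tsum_ne_top hz'), ENNReal.ofReal_toReal hz']

theorem powerSeries_le_of_forall_lt {a : ℕ → ℝ≥0∞} (ha : ∀ n, a n ≠ ∞) {w r C : ℝ≥0∞} (hw : w < r)
    (h : ∀ z, w < z → z < r → ∑' n, a n * z ^ n ≤ C) : ∑' n, a n * r ^ n ≤ C := by
  refine ENNReal.tsum_le_of_sum_range_le fun N => ?_
  have hc : Continuous fun z : ℝ≥0∞ => ∑ n ∈ Finset.range N, a n * z ^ n :=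
    continuous_finsetSum _ fun n _ =>
      (ENNReal.continuous_const_mul (ha n)).comp (ENNReal.continuous_pow n)
  have : (𝓝[<] r).NeBot := nhdsLT_neBot_of_exists_lt ⟨w, hw⟩
  refine le_of_tendsto (hc.continuousWithinAt (s := Iio r) (x := r)) ?_
  filter_upwards [Ioo_mem_nhdsLT hw] with z hz
  exact (ENNReal.sum_le_tsum _).trans (h z hz.1 hz.2)

theorem eventually_powerSeries_le_mul {a : ℕ → ℝ≥0∞} {z z₀ c : ℝ≥0∞} (hz : z < z₀) (hz0 : z ≠ 0)
    (h : ∑' n, a n * z₀ ^ n ≠ ∞) (hc : 1 < c) :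
    ∀ᶠ w in 𝓝[>] z, ∑' n, a n * w ^ n ≤ c * ∑' n, a n * z ^ n := by
  have hz0' : z₀ ≠ 0 := (bot_lt_iff_ne_bot.1 (lt_of_le_of_lt bot_le hz))
  have hcont := continuousOn_powerSeries hz0' h z hz.le
  have hfin : ∑' n, a n * z ^ n ≠ ∞ := ne_top_of_le_ne_top h
    (ENNReal.tsum_le_tsum fun n => by gcongr)
  by_cases hf : ∑' n, a n * z ^ n = 0
  · refine Eventually.of_forall fun w => ?_
    have : ∀ n, a n = 0 := fun n => by
      have := ENNReal.tsum_eq_zero.1 hf n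
      exact (mul_eq_zero.1 this).resolve_right (pow_ne_zero _ hz0)
    simp [this]
  · have hlt : ∑' n, a n * z ^ n < c * ∑' n, a n * z ^ n := by
      conv_lhs => rw [← one_mul (∑' n, a n * z ^ n)]
      exact ENNReal.mul_lt_mul_left hf hfin hc
    have h1 := (hcont.eventually (gt_mem_nhds hlt) : _)
    have h2 : 𝓝[>] z ≤ 𝓝[Iic z₀] z := by
      rw [nhdsWithin_le_iff]
      exact mem_of_superset (Ioo_mem_nhdsGT hz) fun w hw => hw.2.le
    filter_upwards [h2 h1] with w hw using hw.le

theorem eventually_le_mul_powerSeries {a : ℕ → ℝ≥0∞} {r c : ℝ≥0∞} (hr : r ≠ 0)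
    (h : ∑' n, a n * r ^ n ≠ ∞) (hc : 1 < c) :
    ∀ᶠ w in 𝓝[<] r, ∑' n, a n * r ^ n ≤ c * ∑' n, a n * w ^ n := by
  by_cases hf : ∑' n, a n * r ^ n = 0
  · exact Eventually.of_forall fun w => by rw [hf]; exact zero_le
  by_cases hct : c = ∞
  · filter_upwards [self_mem_nhdsWithin, nhdsWithin_le_nhds (lt_mem_nhds (pos_iff_ne_zero.2 hr))]
      with w _ hw0
    have hne : ∑' n, a n * w ^ n ≠ 0 := by
      intro h0
      apply hf
      have : ∀ n, a n = 0 := fun n => (mul_eq_zero.1 (ENNReal.tsum_eq_zero.1 h0 n)).resolve_right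
        (pow_ne_zero _ hw0.ne')
      simp [this]
    rw [hct, ENNReal.top_mul hne]; exact le_top
  have hcont := continuousOn_powerSeries hr h r (self_mem_Iic)
  have hc0 : c ≠ 0 := (zero_lt_one.trans hc).ne'
  have hlt : (∑' n, a n * r ^ n) / c < ∑' n, a n * r ^ n := by
    rw [ENNReal.div_lt_iff (Or.inl hc0) (Or.inl hct)]
    conv_lhs => rw [← mul_one (∑' n, a n * r ^ n)]
    exact ENNReal.mul_lt_mul_right hf h hc
  have h1 := (hcont.eventually (lt_mem_nhds hlt) : _)
  have h2 : 𝓝[<] r ≤ 𝓝[Iic r] r := nhdsWithin_mono _ Iio_subset_Iic_self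
  filter_upwards [h2 h1] with w hw
  rw [mul_comm]
  exact (ENNReal.div_le_iff hc0 hct).1 hw.le

/-- The factor by which laziness `κ` multiplies the weight `z` of a step from a lazy state. -/
def boost (κ : ℝ) (z : ℝ≥0∞) : ℝ≥0∞ := (1 - z * ENNReal.ofReal κ)⁻¹ * ENNReal.ofReal (1 - κ)

theorem one_sub_ofReal {κ : ℝ} (h0 : 0 ≤ κ) : 1 - ENNReal.ofReal κ = ENNReal.ofReal (1 - κ) := by
  rw [ENNReal.ofReal_sub _ h0, ENNReal.ofReal_one]

theorem continuous_boost (κ : ℝ) : Continuous (boost κ) := by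
  unfold boost
  have h : Continuous fun z : ℝ≥0∞ => (1 - z * ENNReal.ofReal κ)⁻¹ := by
    refine continuous_inv.comp ?_
    exact (ENNReal.continuous_sub_left ENNReal.one_ne_top).comp
      (ENNReal.continuous_mul_const ENNReal.ofReal_ne_top)
  exact (ENNReal.continuous_mul_const ENNReal.ofReal_ne_top).comp h

theorem continuousAt_boost_left {κ : ℝ} {z : ℝ≥0∞} (h1 : κ < 1) (hz : z ≠ ∞) :
    ContinuousAt (fun κ => boost κ z) κ := by
  unfold boost
  have h : Continuous fun κ : ℝ => (1 - z * ENNReal.ofReal κ)⁻¹ := by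
    refine continuous_inv.comp ?_
    exact (ENNReal.continuous_sub_left ENNReal.one_ne_top).comp
      ((ENNReal.continuous_const_mul hz).comp ENNReal.continuous_ofReal)
  have h' : Continuous fun κ : ℝ => ENNReal.ofReal (1 - κ) := ENNReal.continuous_ofReal.comp (by fun_prop)
  refine ENNReal.Tendsto.mul h.continuousAt (Or.inr ENNReal.ofReal_ne_top) h'.continuousAt
    (Or.inl ?_)
  simpa using h1

theorem boost_ne_top {κ : ℝ} {z : ℝ≥0∞} (h : z * ENNReal.ofReal κ < 1) : boost κ z ≠ ∞ := by
  refine ENNReal.mul_ne_top (ENNReal.inv_ne_top.2 ?_) ENNReal.ofReal_ne_top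
  exact (tsub_pos_of_lt h).ne'

theorem boost_ne_zero {κ : ℝ} {z : ℝ≥0∞} (h1 : κ < 1) : boost κ z ≠ 0 := by
  refine mul_ne_zero (ENNReal.inv_ne_zero.2 ?_) (by simpa using h1)
  exact ne_top_of_le_ne_top ENNReal.one_ne_top tsub_le_self

theorem boost_eq_top {κ : ℝ} {z : ℝ≥0∞} (h1 : κ < 1) (h : 1 ≤ z * ENNReal.ofReal κ) :
    boost κ z = ∞ := by
  rw [boost, tsub_eq_zero_of_le h, ENNReal.inv_zero, ENNReal.top_mul (by simpa using h1)]

theorem boost_eq_ofReal {κ : ℝ} {z : ℝ≥0∞} (h0 : 0 ≤ κ) (hz : z ≠ ∞)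
    (h : z * ENNReal.ofReal κ < 1) :
    z.toReal * κ < 1 ∧ boost κ z = ENNReal.ofReal ((1 - κ) / (1 - z.toReal * κ)) := by
  have hzk : z * ENNReal.ofReal κ = ENNReal.ofReal (z.toReal * κ) := by
    rw [ENNReal.ofReal_mul ENNReal.toReal_nonneg, ENNReal.ofReal_toReal hz]
  have h' : z.toReal * κ < 1 := by
    rw [hzk, ← ENNReal.ofReal_one, ENNReal.ofReal_lt_ofReal_iff one_pos] at h
    exact h
  refine ⟨h', ?_⟩
  rw [boost, hzk, one_sub_ofReal (by positivity), ← ENNReal.ofReal_inv_of_pos (by linarith),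
    ← ENNReal.ofReal_mul (by rw [inv_nonneg]; linarith), inv_mul_eq_div]

theorem one_le_boost {κ : ℝ} {z : ℝ≥0∞} (h0 : 0 ≤ κ) (h1 : κ < 1) (hz : 1 ≤ z) :
    1 ≤ boost κ z := by
  have h : 1 - z * ENNReal.ofReal κ ≤ ENNReal.ofReal (1 - κ) := by
    rw [← one_sub_ofReal h0]
    gcongr
    exact le_mul_of_one_le_left' hz
  calc (1 : ℝ≥0∞) = (ENNReal.ofReal (1 - κ))⁻¹ * ENNReal.ofReal (1 - κ) :=
        (ENNReal.inv_mul_cancel (by simpa using h1) ENNReal.ofReal_ne_top).symm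
    _ ≤ boost κ z := by unfold boost; gcongr

theorem boost_lt_boost_left {κ κ' : ℝ} {z : ℝ≥0∞} (h0 : 0 ≤ κ) (h : κ < κ') (h1 : κ' < 1)
    (hz : 1 < z) (hztop : z ≠ ∞) (hzk : z * ENNReal.ofReal κ < 1) : boost κ z < boost κ' z := by
  rcases lt_or_ge (z * ENNReal.ofReal κ') 1 with h' | h'
  · obtain ⟨a, b⟩ := boost_eq_ofReal h0 hztop hzk
    obtain ⟨a', b'⟩ := boost_eq_ofReal (h0.trans h.le) hztop h'
    have hz1 : 1 < z.toReal := by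
      rw [← ENNReal.toReal_one]; exact (ENNReal.toReal_lt_toReal ENNReal.one_ne_top hztop).2 hz
    rw [b, b', ENNReal.ofReal_lt_ofReal_iff (div_pos (by linarith) (by linarith)),
      div_lt_div_iff₀ (by linarith) (by linarith)]
    -- After cross-multiplication the two sides differ by (z - 1)(κ' - κ).
    nlinarith
  · rw [boost_eq_top h1 h']
    exact (boost_ne_top hzk).lt_top

theorem boost_le_boost_left {κ κ' : ℝ} {z : ℝ≥0∞} (h0 : 0 ≤ κ) (h : κ ≤ κ') (h1 : κ' < 1)
    (hz : 1 < z) (hztop : z ≠ ∞) : boost κ z ≤ boost κ' z := by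
  rcases h.eq_or_lt with rfl | h
  · rfl
  rcases lt_or_ge (z * ENNReal.ofReal κ) 1 with h' | h'
  · exact (boost_lt_boost_left h0 h h1 hz hztop h').le
  · rw [boost_eq_top h1 (h'.trans (by gcongr))]
    exact le_top

theorem boost_lt_boost_right {κ : ℝ} {z z' : ℝ≥0∞} (h0 : 0 < κ) (h1 : κ < 1) (h : z < z')
    (hzk : z * ENNReal.ofReal κ < 1) : boost κ z < boost κ z' := by
  unfold boost
  refine ENNReal.mul_lt_mul_left (by simpa using h1) ENNReal.ofReal_ne_top ?_
  rw [ENNReal.inv_lt_inv]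
  have hlt : z * ENNReal.ofReal κ < z' * ENNReal.ofReal κ :=
    ENNReal.mul_lt_mul_left (by simpa using h0) ENNReal.ofReal_ne_top h
  rcases le_or_gt 1 (z' * ENNReal.ofReal κ) with h' | h'
  · rw [tsub_eq_zero_of_le h']
    exact tsub_pos_of_lt hzk
  · refine ENNReal.sub_lt_of_lt_add h'.le ?_
    conv_lhs => rw [← tsub_add_cancel_of_le hzk.le]
    exact ENNReal.add_lt_add_left (ENNReal.sub_ne_top ENNReal.one_ne_top) hlt

end

/-! ### Reduction to first returns to L; lazy and killed matrices -/

section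

open Filter Topology

namespace InfMat

variable {S : Type*}

open scoped Classical in
/-- `z A`, with the rows in `L` multiplied further by `t`. -/
def weighted (L : Set S) (t z : ℝ≥0∞) (A : InfMat S) : InfMat S :=
  row (fun x => if x ∈ L then t * z else z) A

/-- The generating functions at `z` of the first returns to `L`. -/
def returnMat (L : Set S) (z : ℝ≥0∞) (A : InfMat S) : InfMat S :=
  row (L.indicator fun _ => z) A * star (row (Lᶜ.indicator fun _ => z) A)

/-- The power series coefficients of `returnMat`. -/
def returnCoeff (L : Set S) (A : InfMat S) (x y : S) : ℕ → ℝ≥0∞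
  | 0 => 0
  | k + 1 => (row (L.indicator 1) A * row (Lᶜ.indicator 1) A ^ k) x y

theorem row_indicator (L : Set S) (z : ℝ≥0∞) (A : InfMat S) :
    row (L.indicator fun _ => z) A = row (fun _ => z) (row (L.indicator 1) A) := by
  ext x y
  by_cases h : x ∈ L <;> simp [row_apply, h]

theorem returnMat_apply (L : Set S) (z : ℝ≥0∞) (A : InfMat S) (x y : S) :
    returnMat L z A x y = ∑' n, returnCoeff L A x y n * z ^ n := by
  have h : ∑' n, returnCoeff L A x y n * z ^ n = returnCoeff L A x y 0 * z ^ 0 +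
      ∑' k, returnCoeff L A x y (k + 1) * z ^ (k + 1) := tsum_eq_zero_add' ENNReal.summable
  rw [returnMat, mul_star, h]
  simp only [returnCoeff, zero_mul, zero_add]
  refine tsum_congr fun k => ?_
  rw [row_indicator L, row_indicator Lᶜ, row_const_pow, mul_row_const, row_mul, row_row,
    row_apply, pow_succ, mul_comm]

theorem returnMat_mono (L : Set S) (A : InfMat S) {z z' : ℝ≥0∞} (h : z ≤ z') :
    returnMat L z A ≤ returnMat L z' A := by
  refine mul_le_mul'' (row_mono (fun x => ?_) le_rfl) (star_mono (row_mono (fun x => ?_) le_rfl))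
  · exact indicator_le_indicator h
  · exact indicator_le_indicator h

theorem returnMat_le_star (L : Set S) (A : InfMat S) (z : ℝ≥0∞) :
    returnMat L z A ≤ star (row (fun _ => z) A) := by
  refine le_trans (mul_le_mul'' ?_ (star_mono ?_)) (mul_star_le_star _)
  · exact row_mono (fun x => indicator_le_self _ _ _) le_rfl
  · exact row_mono (fun x => indicator_le_self _ _ _) le_rfl

theorem weighted_eq (L : Set S) (t z : ℝ≥0∞) (A : InfMat S) :
    weighted L t z A = row (Lᶜ.indicator fun _ => z) A +
      row (fun _ => t) (row (L.indicator fun _ => z) A) := by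
  ext x y
  by_cases h : x ∈ L <;> simp [weighted, row_apply, h, mul_assoc]

/-- After an initial stretch outside L, a path splits into excursions, each starting with a step
from L and so carrying exactly one factor t. The initial stretch is trivial for a start in L. -/
theorem star_weighted (L : Set S) (t z : ℝ≥0∞) (A : InfMat S) :
    star (weighted L t z A) = star (row (Lᶜ.indicator fun _ => z) A) *
      star (row (fun _ => t) (returnMat L z A)) := by
  rw [weighted_eq, star_add, row_mul, returnMat]

theorem star_weighted_apply {L : Set S} {x : S} (hx : x ∈ L) (t z : ℝ≥0∞) (A : InfMat S) (y : S) :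
    star (weighted L t z A) x y = star (row (fun _ => t) (returnMat L z A)) x y := by
  rw [star_weighted]
  refine mul_apply_of_row_eq (fun w => star_apply_of_row_eq_zero (fun u => ?_) w) y
  simp [row_apply, hx]

theorem returnMat_apply_of_notMem {L : Set S} {x : S} (hx : x ∉ L) (z : ℝ≥0∞) (A : InfMat S)
    (y : S) : returnMat L z A x y = 0 := by
  simp [returnMat, row_mul, row_apply, hx]

theorem weighted_mono {L : Set S} {t t' z z' : ℝ≥0∞} {A A' : InfMat S} (ht : t ≤ t') (hz : z ≤ z')
    (hA : A ≤ A') : weighted L t z A ≤ weighted L t' z' A' := by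
  refine row_mono (fun x => ?_) hA
  split_ifs
  · gcongr
  · exact hz

theorem weighted_one (L : Set S) (z : ℝ≥0∞) (A : InfMat S) :
    weighted L 1 z A = row (fun _ => z) A := by simp [weighted]

-- The row sums f of the Neumann series of V over L satisfy 1 + Vf ≤ f on L. If f ≤ C there and c =
-- 1 + 1/(2C), then 1 + cV(2f) ≤ 2 + 2Vf ≤ 2f, so 2f is a supersolution for every matrix below cV.
-- Finiteness of L provides C.
open scoped Classical in
theorem exists_forall_star_weighted_ne_top {L : Set S} (hL : L.Finite) {t z : ℝ≥0∞} {A : InfMat S}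
    (h : ∀ x ∈ L, ∀ y ∈ L, star (weighted L t z A) x y ≠ ∞) :
    ∃ c : ℝ≥0∞, 1 < c ∧ c ≠ ∞ ∧ ∀ (t' z' : ℝ≥0∞) (A' : InfMat S),
      (∀ x ∈ L, ∀ y ∈ L, t' * returnMat L z' A' x y ≤ c * (t * returnMat L z A x y)) →
      ∀ x ∈ L, ∀ y ∈ L, star (weighted L t' z' A') x y ≠ ∞ := by
  lift L to Finset S using hL
  simp only [Finset.mem_coe] at *
  rcases L.eq_empty_or_nonempty with rfl | hne
  · exact ⟨2, by norm_num, by norm_num, by simp⟩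
  set V := row (fun _ => t) (returnMat (L : Set S) z A) with hV
  set f : S → ℝ≥0∞ := fun x => ∑ y ∈ L, star V x y with hf
  have hfV : ∀ x ∈ L, 1 + ∑ s ∈ L, V x s * f s ≤ f x := by
    intro x hx
    calc 1 + ∑ s ∈ L, V x s * f s ≤ ∑ y ∈ L, (1 : InfMat S) x y +
          ∑ y ∈ L, ∑ s ∈ L, V x s * star V s y := by
          refine add_le_add ?_ ?_
          · simp [one_apply, hx]
          · rw [Finset.sum_comm]
            simp only [hf, Finset.mul_sum, le_refl]
      _ ≤ ∑ y ∈ L, (1 : InfMat S) x y + ∑ y ∈ L, (V * star V) x y := by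
          gcongr
          exact ENNReal.sum_le_tsum _
      _ = f x := by
          rw [← Finset.sum_add_distrib]
          simp only [hf]
          conv_rhs => rw [star_eq_one_add_mul]
          rfl
  have hffin : ∀ x ∈ L, f x ≠ ∞ := by
    intro x hx
    refine ENNReal.sum_ne_top.2 fun y hy => ?_
    rw [hV, ← star_weighted_apply (L := (L : Set S)) hx]
    exact h x hx y hy
  obtain ⟨C, hCtop, hC⟩ : ∃ C : ℝ≥0∞, C ≠ ∞ ∧ ∀ x ∈ L, f x ≤ C :=
    ⟨∑ x ∈ L, f x, ENNReal.sum_ne_top.2 hffin, fun x hx => Finset.single_le_sum (by simp) hx⟩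
  obtain ⟨x₀, hx₀⟩ := hne
  have hC1 : 1 ≤ C := (le_trans le_self_add (hfV x₀ hx₀)).trans (hC x₀ hx₀)
  have hC0 : C ≠ 0 := (zero_lt_one.trans_le hC1).ne'
  have hC2 : (2 * C)⁻¹ ≠ 0 := ENNReal.inv_ne_zero.2 (ENNReal.mul_ne_top (by norm_num) hCtop)
  have hC3 : (2 * C)⁻¹ ≠ ∞ := ENNReal.inv_ne_top.2 (mul_ne_zero (by norm_num) hC0)
  refine ⟨1 + (2 * C)⁻¹, ENNReal.lt_add_right ENNReal.one_ne_top hC2,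
    ENNReal.add_ne_top.2 ⟨ENNReal.one_ne_top, hC3⟩, fun t' z' A' hle x hx y hy => ?_⟩
  rw [star_weighted_apply (L := (L : Set S)) hx]
  set V' := row (fun _ => t') (returnMat (L : Set S) z' A') with hV'
  -- The value ∞ makes columns outside L trivial; the value 0 is admissible on the remaining rows
  -- because V' vanishes there.
  set X : InfMat S := fun x y => if y ∈ L then (if x ∈ L then 2 * f x else 0) else ∞ with hX
  have hrow : ∀ x ∉ L, ∀ y, V' x y = 0 := fun x hx y => by
    rw [hV', row_apply, returnMat_apply_of_notMem (L := (L : Set S)) hx, mul_zero]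
  have key : 1 + V' * X ≤ X := by
    intro x y
    by_cases hy : y ∈ L
    swap
    · simp [hX, hy]
    by_cases hx : x ∈ L
    swap
    · have hxy : x ≠ y := fun e => hx (e ▸ hy)
      simp [one_apply_ne hxy, mul_apply, hrow x hx]
    have h1 : (V' * X) x y = ∑ s ∈ L, V' x s * (2 * f s) := by
      rw [mul_apply, tsum_eq_sum (s := L)]
      · exact Finset.sum_congr rfl fun s hs => by simp [hX, hy, hs]
      · intro s hs; simp [hX, hy, hs]
    have h2 : (V' * X) x y ≤ (1 + (2 * C)⁻¹) * (2 * ∑ s ∈ L, V x s * f s) := by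
      rw [h1, Finset.mul_sum, Finset.mul_sum]
      refine Finset.sum_le_sum fun s hs => ?_
      calc V' x s * (2 * f s) ≤ ((1 + (2 * C)⁻¹) * V x s) * (2 * f s) := by
            gcongr; exact hle x hx s hs
        _ = _ := by ring
    have hone : (1 : InfMat S) x y ≤ 1 := by rw [one_apply]; split_ifs <;> simp
    have hsum : ∑ s ∈ L, V x s * f s ≤ C :=
      le_trans le_add_self ((hfV x hx).trans (hC x hx))
    rw [add_apply]
    calc (1 : InfMat S) x y + (V' * X) x y
        ≤ 1 + (1 + (2 * C)⁻¹) * (2 * ∑ s ∈ L, V x s * f s) := add_le_add hone h2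
      _ = 1 + (2 * C)⁻¹ * 2 * (∑ s ∈ L, V x s * f s) + 2 * ∑ s ∈ L, V x s * f s := by ring
      _ ≤ 1 + (2 * C)⁻¹ * 2 * C + 2 * ∑ s ∈ L, V x s * f s := by gcongr
      _ = 1 + 1 + 2 * ∑ s ∈ L, V x s * f s := by
          rw [mul_assoc, ENNReal.inv_mul_cancel (mul_ne_zero (by norm_num) hC0)
            (ENNReal.mul_ne_top (by norm_num) hCtop)]
      _ = 2 * (1 + ∑ s ∈ L, V x s * f s) := by rw [mul_add, one_add_one_eq_two, mul_one]
      _ ≤ 2 * f x := by gcongr; exact hfV x hx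
      _ = X x y := by simp [hX, hx, hy]
  refine ne_top_of_le_ne_top ?_ (star_le key x y)
  simp only [hX, hx, hy, if_true]
  exact ENNReal.mul_ne_top (by norm_num) (hffin x hx)

open scoped Classical in
/-- The lazy version of `A` with laziness `κ` on `L`. -/
def lazyMat (L : Set S) (κ : ℝ) (A : InfMat S) : InfMat S :=
  row (fun x => if x ∈ L then ENNReal.ofReal κ else 0) 1 +
    row (fun x => if x ∈ L then ENNReal.ofReal (1 - κ) else 1) A

open scoped Classical in
theorem star_lazyMat (L : Set S) (κ : ℝ) (z : ℝ≥0∞) (A : InfMat S) (x y : S) :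
    star (row (fun _ => z) (lazyMat L κ A)) x y =
      star (weighted L (boost κ z) z A) x y *
        if y ∈ L then (1 - z * ENNReal.ofReal κ)⁻¹ else 1 := by
  have h : row (fun _ => z) (lazyMat L κ A) =
      row (fun x => if x ∈ L then z * ENNReal.ofReal κ else 0) 1 +
        row (fun x => if x ∈ L then z * ENNReal.ofReal (1 - κ) else z) A := by
    ext u v
    by_cases hu : u ∈ L <;> simp [lazyMat, row_apply, hu, mul_add, mul_assoc]
  rw [h, star_add', star_row_one, row_mul, one_mul, row_row, mul_row_one]
  congr 2
  · congr 1
    ext u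
    by_cases hu : u ∈ L
    · simp only [hu, if_true, boost]; ring
    · simp [hu]
  · by_cases hy : y ∈ L <;> simp [hy]

/-- `A` with the row `x` replaced by zero. -/
def kill (x : S) (A : InfMat S) : InfMat S := row (({x}ᶜ : Set S).indicator 1) A

theorem kill_apply_self (x y : S) (A : InfMat S) : kill x A x y = 0 := by simp [kill, row_apply]

theorem kill_apply_of_ne {x u : S} (h : u ≠ x) (y : S) (A : InfMat S) : kill x A u y = A u y := by
  simp [kill, row_apply, h]

theorem kill_le (x : S) (A : InfMat S) : kill x A ≤ A := fun u y => by
  by_cases h : u = x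
  · subst h; rw [kill_apply_self]; exact zero_le
  · rw [kill_apply_of_ne h]

theorem kill_row (x : S) (a : S → ℝ≥0∞) (A : InfMat S) : kill x (row a A) = row a (kill x A) := by
  simp only [kill, row_row, mul_comm]

theorem kill_lazyMat (x : S) (L : Set S) (κ : ℝ) (A : InfMat S) :
    kill x (lazyMat L κ A) = lazyMat (L \ {x}) κ (kill x A) := by
  ext u v
  by_cases h : u = x
  · subst h; simp [kill_apply_self, lazyMat, row_apply]
  · rw [kill_apply_of_ne h]
    have h' : u ∈ L \ {x} ↔ u ∈ L := by simp [h]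
    by_cases hu : u ∈ L <;> simp only [lazyMat, add_apply, row_apply, kill_apply_of_ne h, h', hu]

theorem weighted_kill (x : S) (L : Set S) (t z : ℝ≥0∞) (A : InfMat S) :
    weighted (L \ {x}) t z (kill x A) = weighted L t z (kill x A) := by
  ext u v
  by_cases h : u = x
  · subst h; simp [kill_apply_self, weighted, row_apply]
  · have h' : u ∈ L \ {x} ↔ u ∈ L := by simp [h]
    by_cases hu : u ∈ L <;> simp only [weighted, row_apply, h', hu]

theorem returnMat_singleton (x : S) (z : ℝ≥0∞) (A : InfMat S) (y : S) :
    returnMat {x} z A x y =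
      (row (fun _ => z) A * star (kill x (row (fun _ => z) A))) x y := by
  have h : kill x (row (fun _ => z) A) = row (({x}ᶜ : Set S).indicator fun _ => z) A := by
    rw [row_indicator, kill_row, kill]
  rw [returnMat, h]
  simp [mul_apply, row_apply]

end InfMat

end

/-! ### Path probabilities as matrix powers; radii of convergence -/

section

open Filter Topology InfMat

variable {S : Type*}

/-- The transition matrix of `P`, with entries in `[0, ∞]`. -/
def probMat (P : S → S → ℝ) : InfMat S := fun x y => ENNReal.ofReal (P x y)

theorem tsum_cons {n : ℕ} (F : (Fin (n + 2) → S) → ℝ≥0∞) :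
    ∑' w, F w = ∑' s, ∑' w : Fin (n + 1) → S, F (Fin.cons s w) := by
  rw [← ENNReal.tsum_prod (f := fun s (w : Fin (n + 1) → S) => F (Fin.cons s w))]
  exact ((Fin.consEquiv fun _ : Fin (n + 2) => S).tsum_eq F).symm

open scoped Classical in
theorem tsum_first_step {n : ℕ} (A : InfMat S) (x : S) (g : (Fin (n + 1) → S) → ℝ≥0∞) :
    ∑' w : Fin (n + 2) → S, (if w 0 = x then A (w 0) (w 1) * g (Fin.tail w) else 0) =
      ∑' v, A x v * ∑' w : Fin (n + 1) → S, if w 0 = v then g w else 0 := by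
  rw [tsum_cons, tsum_eq_single x]
  · simp only [Fin.cons_zero, if_true, Fin.tail_cons, ← ENNReal.tsum_mul_left]
    rw [ENNReal.tsum_comm]
    refine tsum_congr fun w => ?_
    rw [tsum_eq_single (w 0)]
    · simp only [if_true]; rfl
    · intro v hv; simp [hv.symm]
  · intro s hs; simp [hs]

open scoped Classical in
theorem pow_apply_eq_tsum (A : InfMat S) (n : ℕ) (x y : S) :
    (A ^ n) x y = ∑' w : Fin (n + 1) → S,
      if w 0 = x ∧ w (Fin.last n) = y then ∏ i : Fin n, A (w i.castSucc) (w i.succ) else 0 := by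
  induction n generalizing x with
  | zero =>
    rw [← (Equiv.funUnique (Fin 1) S).symm.tsum_eq, tsum_eq_single x]
    · by_cases h : x = y <;> simp [h, one_apply]
    · intro v hv; simp [hv]
  | succ n ih =>
    have h := tsum_first_step A x (fun w : Fin (n + 1) → S =>
      if w (Fin.last n) = y then ∏ i : Fin n, A (w i.castSucc) (w i.succ) else 0)
    rw [pow_succ', mul_apply]
    simp only [ih, ite_and]
    rw [← h]
    refine tsum_congr fun w => ?_
    by_cases h0 : w 0 = x
    · by_cases h1 : w (Fin.last (n + 1)) = y
      · simp only [h0, h1, if_true, Fin.tail, Fin.succ_last]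
        rw [Fin.prod_univ_succ]
        simp [h0]
      · simp [h0, h1, Fin.tail]
    · simp [h0]

variable {P : S → S → ℝ}

theorem ofReal_prod (hP : ∀ x y, 0 ≤ P x y) {n : ℕ} (w : Fin (n + 1) → S) :
    ENNReal.ofReal (∏ i : Fin n, P (w i.castSucc) (w i.succ)) =
      ∏ i : Fin n, probMat P (w i.castSucc) (w i.succ) :=
  ENNReal.ofReal_prod_of_nonneg fun _ _ => hP _ _

theorem stepProb_eq (hP : ∀ x y, 0 ≤ P x y) (x y : S) (n : ℕ) :
    stepProb P x y n = (probMat P ^ n) x y := by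
  rw [pow_apply_eq_tsum, stepProb, pathProb]
  simp only [ofReal_prod hP, mem_ofPred_eq]

theorem firstHitProb_zero (x y : S) : firstHitProb P x y 0 = 0 := by
  rw [firstHitProb, pathProb, ENNReal.tsum_eq_zero]
  intro w
  refine if_neg fun h => ?_
  have := h.2.1.1
  simp at this

open scoped Classical in
theorem prod_kill (A : InfMat S) (y : S) {n : ℕ} (w : Fin (n + 1) → S) :
    ∏ i : Fin n, kill y A (w i.castSucc) (w i.succ) =
      if ∀ i : Fin n, w i.castSucc ≠ y then ∏ i : Fin n, A (w i.castSucc) (w i.succ) else 0 := by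
  split_ifs with h
  · exact Finset.prod_congr rfl fun i _ => kill_apply_of_ne (h i) _ _
  · push Not at h
    obtain ⟨i, hi⟩ := h
    exact Finset.prod_eq_zero (Finset.mem_univ i) (by rw [hi, kill_apply_self])

theorem isLeast_last_iff {n : ℕ} (w : Fin (n + 2) → S) (y : S) :
    IsLeast {k : Fin (n + 2) | 1 ≤ (k : ℕ) ∧ w k = y} (Fin.last (n + 1)) ↔
      w (Fin.last (n + 1)) = y ∧ ∀ i : Fin n, w i.castSucc.succ ≠ y := by
  constructor
  · rintro ⟨h1, h2⟩
    refine ⟨h1.2, fun i hi => ?_⟩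
    have := h2 (a := i.castSucc.succ) ⟨by simp, hi⟩
    rw [Fin.le_def] at this
    simp at this
    omega
  · rintro ⟨h1, h2⟩
    refine ⟨⟨by simp, h1⟩, fun k hk => ?_⟩
    by_contra hlt
    rw [not_le] at hlt
    have h3 : (k : ℕ) < n + 1 := by simpa [Fin.lt_def] using hlt
    have h4 := hk.1
    refine h2 ⟨k - 1, by omega⟩ ?_
    rw [← hk.2]
    congr 1
    ext
    simp
    omega

/-- The first step is unrestricted, since time 0 does not count as a hit; all later steps must start
away from y. -/
theorem firstHitProb_succ (hP : ∀ x y, 0 ≤ P x y) (x y : S) (n : ℕ) :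
    firstHitProb P x y (n + 1) = (probMat P * kill y (probMat P) ^ n) x y := by
  classical
  have h := tsum_first_step (probMat P) x (fun w : Fin (n + 1) → S =>
      if w (Fin.last n) = y then
        ∏ i : Fin n, kill y (probMat P) (w i.castSucc) (w i.succ) else 0)
  rw [mul_apply]
  simp only [pow_apply_eq_tsum, ite_and]
  rw [← h, firstHitProb, pathProb]
  refine tsum_congr fun w => ?_
  by_cases h0 : w 0 = x
  · rw [prod_kill, ← h0]
    simp only [mem_ofPred_eq, true_and, isLeast_last_iff, if_true, ofReal_prod hP]
    by_cases h1 : w (Fin.last (n + 1)) = y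
    · by_cases h2 : ∀ i : Fin n, w i.castSucc.succ ≠ y
      · simp only [h1, h2, Fin.tail, Fin.succ_last, if_true, ne_eq, not_false_iff, implies_true,
          and_self]
        rw [Fin.prod_univ_succ]
        simp
      · simp only [h1, h2, Fin.tail, Fin.succ_last, if_true, and_false, if_false, mul_zero]
    · simp only [h1, Fin.tail, Fin.succ_last, if_false, false_and, mul_zero]
  · simp [h0]

theorem green_eq (hP : ∀ x y, 0 ≤ P x y) (x y : S) (z : ℝ≥0∞) :
    green P x y z = star (row (fun _ => z) (probMat P)) x y := by
  simp only [green, star_apply, row_const_pow, row_apply, stepProb_eq hP, mul_comm]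

theorem tsum_firstHitProb (hP : ∀ x y, 0 ≤ P x y) (x : S) (z : ℝ≥0∞) :
    ∑' n, firstHitProb P x x n * z ^ n = returnMat {x} z (probMat P) x x := by
  have h : ∑' n, firstHitProb P x x n * z ^ n = firstHitProb P x x 0 * z ^ 0 +
      ∑' k, firstHitProb P x x (k + 1) * z ^ (k + 1) := tsum_eq_zero_add' ENNReal.summable
  rw [h, firstHitProb_zero, zero_mul, zero_add, returnMat_singleton, mul_star]
  refine tsum_congr fun k => ?_
  rw [firstHitProb_succ hP, kill_row, row_const_pow, mul_row_const, row_mul, row_row, row_apply,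
    pow_succ, mul_comm]

theorem le_convRadius {a : ℕ → ℝ≥0∞} {z : ℝ≥0∞} (hz : z ≠ ∞) (h : ∑' n, a n * z ^ n ≠ ∞) :
    z ≤ convRadius a := by
  lift z to NNReal using hz
  refine FormalMultilinearSeries.le_radius_of_summable_norm _ ?_
  refine (ENNReal.summable_toReal h).congr fun n => ?_
  simp [ENNReal.toReal_mul]

theorem tsum_ne_top_of_lt_convRadius {a : ℕ → ℝ≥0∞} (ha : ∀ n, a n ≠ ∞) {z : ℝ≥0∞}
    (hz : z < convRadius a) : ∑' n, a n * z ^ n ≠ ∞ := by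
  lift z to NNReal using hz.ne_top
  have h := FormalMultilinearSeries.summable_norm_mul_pow _ hz
  simp only [FormalMultilinearSeries.ofScalars_norm, Real.norm_of_nonneg ENNReal.toReal_nonneg] at h
  have h2 : ∀ n, a n * (z : ℝ≥0∞) ^ n = ENNReal.ofReal ((a n).toReal * (z : ℝ) ^ n) := fun n => by
    rw [ENNReal.ofReal_mul ENNReal.toReal_nonneg, ENNReal.ofReal_toReal (ha n),
      ENNReal.ofReal_pow z.coe_nonneg, ENNReal.ofReal_coe_nnreal]
  simp only [h2]
  exact h.tsum_ofReal_ne_top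

end

/-! ### Green radius and its perturbation under laziness -/

section

open Filter Topology

namespace InfMat

variable {S : Type*}

/-- Every entry of the Neumann series of `A` is nonzero. -/
def Connected (A : InfMat S) : Prop := ∀ x y, star A x y ≠ 0

theorem Connected.row_const {A : InfMat S} (hA : A.Connected) {z : ℝ≥0∞} (hz : z ≠ 0) :
    (row (fun _ => z) A).Connected := by
  intro x y h
  obtain ⟨n, hn⟩ := exists_pow_ne_zero (hA x y)
  have := le_trans (pow_le_star (row (fun _ => z) A) n x y) h.le
  rw [row_const_pow, row_apply, nonpos_iff_eq_zero, mul_eq_zero] at this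
  exact this.elim (pow_ne_zero n hz) hn

theorem Connected.mono {A B : InfMat S} (hA : A.Connected) (h : A ≤ B) : B.Connected :=
  fun x y h0 => hA x y (le_antisymm (h0 ▸ star_mono h x y) zero_le)

theorem row_le_lazyMat {L : Set S} {κ : ℝ} (h0 : 0 ≤ κ) (A : InfMat S) :
    row (fun _ => ENNReal.ofReal (1 - κ)) A ≤ lazyMat L κ A := by
  refine le_trans (row_mono (fun x => ?_) le_rfl) (le_add_left'' _ _)
  split_ifs
  · rfl
  · exact ENNReal.ofReal_le_one.2 (by linarith)

theorem Connected.lazyMat {A : InfMat S} (hA : A.Connected) {L : Set S} {κ : ℝ} (h0 : 0 ≤ κ)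
    (h1 : κ < 1) : (lazyMat L κ A).Connected :=
  (hA.row_const (by simpa using h1)).mono (row_le_lazyMat h0 A)

theorem Connected.star_ne_top {A : InfMat S} (hA : A.Connected) {z : ℝ≥0∞} (hz : z ≠ 0) {x y : S}
    (h : star (row (fun _ => z) A) x y ≠ ∞) (u v : S) : star (row (fun _ => z) A) u v ≠ ∞ :=
  star_ne_top_of_star_ne_top h (hA.row_const hz x u) (hA.row_const hz v y)

theorem star_row_const_mono {z z' : ℝ≥0∞} (h : z ≤ z') (A : InfMat S) :
    star (row (fun _ => z) A) ≤ star (row (fun _ => z') A) :=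
  star_mono (row_mono (fun _ => h) le_rfl)

theorem star_returnMat_apply {L : Set S} {x : S} (hx : x ∈ L) (z : ℝ≥0∞) (A : InfMat S) (y : S) :
    star (returnMat L z A) x y = star (row (fun _ => z) A) x y := by
  rw [← weighted_one L, star_weighted_apply hx]
  congr 2
  ext
  simp [row_apply]

/-- Finiteness holds at the radius r itself: closing up with a fixed path from y to x, weighted at
some w < r, gives loops at x of weight below 1 for z < r. This bounds the series uniformly as z
tends to r. -/
theorem Connected.returnMat_ne_top {A : InfMat S} (hA : A.Connected) {L : Set S} {r : ℝ≥0∞}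
    (hr : r ≠ 0) {x y : S} (hx : x ∈ L) (hy : y ∈ L)
    (h : ∀ z < r, star (row (fun _ => z) A) x x ≠ ∞) : returnMat L r A x y ≠ ∞ := by
  obtain ⟨w, hw0, hwr⟩ := exists_between (pos_iff_ne_zero.2 hr)
  have h1 := hA.row_const hw0.ne' y x
  rw [← star_returnMat_apply hy] at h1
  obtain ⟨m, hm⟩ := exists_pow_ne_zero h1
  have hbd : ∀ z, w < z → z < r → returnMat L z A x y ≤ ((returnMat L w A ^ m) y x)⁻¹ := by
    intro z hwz hzr
    have h2 : (returnMat L z A ^ (m + 1)) x x < 1 := by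
      refine star_ne_top_of_pow ?_ m.succ_pos
      rw [star_returnMat_apply hx]
      exact h z hzr
    rw [ENNReal.le_inv_iff_mul_le]
    refine le_trans ?_ h2.le
    rw [pow_succ']
    refine le_trans ?_ (mul_apply_le _ _ _ y _)
    gcongr
    exact pow_mono (returnMat_mono L A hwz.le) m y x
  have hcoef : ∀ n, returnCoeff L A x y n ≠ ∞ := by
    intro n hn
    have h3 : returnMat L w A x y ≠ ∞ := ne_top_of_le_ne_top
      (hA.star_ne_top hw0.ne' (h w hwr) x y) (returnMat_le_star L A w x y)
    rw [returnMat_apply] at h3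
    exact ENNReal.ne_top_of_tsum_ne_top h3 n (by
      rw [hn, ENNReal.top_mul (pow_ne_zero _ hw0.ne')])
  rw [returnMat_apply]
  refine ne_top_of_le_ne_top (ENNReal.inv_ne_top.2 hm)
    (powerSeries_le_of_forall_lt hcoef hwr fun z h1 h2 => ?_)
  rw [← returnMat_apply]
  exact hbd z h1 h2

theorem exists_mul_self_lt {c : ℝ≥0∞} (hc : 1 < c) : ∃ d : ℝ≥0∞, 1 < d ∧ d * d < c := by
  have h : ContinuousAt (fun x : ℝ≥0∞ => x ^ 2) 1 := (ENNReal.continuous_pow 2).continuousAt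
  have h1 := h.eventually (gt_mem_nhds (by simpa using hc))
  have : (𝓝[>] (1 : ℝ≥0∞)).NeBot := nhdsGT_neBot_of_exists_gt ⟨2, by norm_num⟩
  obtain ⟨d, hd, hd'⟩ := ((h1.filter_mono nhdsWithin_le_nhds).and
    (eventually_mem_nhdsWithin (s := Ioi (1 : ℝ≥0∞)))).exists
  exact ⟨d, hd', by rwa [← sq]⟩

theorem eventually_returnMat_le_mul {L : Set S} (hL : L.Finite) {A : InfMat S} {z z₀ c : ℝ≥0∞}
    (hz : z < z₀) (hz0 : z ≠ 0) (h : ∀ x ∈ L, ∀ y ∈ L, returnMat L z₀ A x y ≠ ∞) (hc : 1 < c) :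
    ∀ᶠ w in 𝓝[>] z, ∀ x ∈ L, ∀ y ∈ L, returnMat L w A x y ≤ c * returnMat L z A x y := by
  rw [hL.eventually_all]
  intro x hx
  rw [hL.eventually_all]
  intro y hy
  simp only [returnMat_apply]
  refine eventually_powerSeries_le_mul hz hz0 ?_ hc
  rw [← returnMat_apply]
  exact h x hx y hy

theorem eventually_le_mul_returnMat {L : Set S} (hL : L.Finite) {A : InfMat S} {r c : ℝ≥0∞}
    (hr : r ≠ 0) (h : ∀ x ∈ L, ∀ y ∈ L, returnMat L r A x y ≠ ∞) (hc : 1 < c) :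
    ∀ᶠ w in 𝓝[<] r, ∀ x ∈ L, ∀ y ∈ L, returnMat L r A x y ≤ c * returnMat L w A x y := by
  rw [hL.eventually_all]
  intro x hx
  rw [hL.eventually_all]
  intro y hy
  simp only [returnMat_apply]
  refine eventually_le_mul_powerSeries hr ?_ hc
  rw [← returnMat_apply]
  exact h x hx y hy

theorem eventually_boost_le_mul {κ : ℝ} (h1 : κ < 1) (z : ℝ≥0∞) {c : ℝ≥0∞} (hc : 1 < c) :
    ∀ᶠ w in 𝓝 z, boost κ w ≤ c * boost κ z := by
  by_cases ht : boost κ z = ∞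
  · refine Eventually.of_forall fun w => ?_
    rw [ht, ENNReal.mul_top (zero_lt_one.trans hc).ne']
    exact le_top
  · have hlt : boost κ z < c * boost κ z := by
      conv_lhs => rw [← one_mul (boost κ z)]
      exact ENNReal.mul_lt_mul_left (boost_ne_zero h1) ht hc
    filter_upwards [(continuous_boost κ).continuousAt.eventually (gt_mem_nhds hlt)] with w hw
      using hw.le

theorem eventually_star_weighted_ne_top {L : Set S} (hL : L.Finite) {A : InfMat S} {κ : ℝ}
    (h1 : κ < 1) {z z₀ : ℝ≥0∞} (hz : z < z₀) (hz0 : z ≠ 0)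
    (hret : ∀ x ∈ L, ∀ y ∈ L, returnMat L z₀ A x y ≠ ∞)
    (h : ∀ x ∈ L, ∀ y ∈ L, star (weighted L (boost κ z) z A) x y ≠ ∞) :
    ∀ᶠ w in 𝓝[>] z, ∀ x ∈ L, ∀ y ∈ L, star (weighted L (boost κ w) w A) x y ≠ ∞ := by
  obtain ⟨c, hc, -, H⟩ := exists_forall_star_weighted_ne_top hL h
  -- The admissible factor c is shared between the growth of `boost` and that of the return series.
  obtain ⟨d, hd, hdc⟩ := exists_mul_self_lt hc
  filter_upwards [eventually_returnMat_le_mul hL hz hz0 hret hd,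
    nhdsWithin_le_nhds (eventually_boost_le_mul h1 z hd)] with w hw hb
  refine H _ _ _ fun x hx y hy => ?_
  calc boost κ w * returnMat L w A x y
      ≤ (d * boost κ z) * (d * returnMat L z A x y) := mul_le_mul' hb (hw x hx y hy)
    _ = d * d * (boost κ z * returnMat L z A x y) := by ring
    _ ≤ c * (boost κ z * returnMat L z A x y) := by gcongr

theorem eventually_star_weighted_ne_top_left {L : Set S} (hL : L.Finite) {A : InfMat S} {κ : ℝ}
    (h1 : κ < 1) {z : ℝ≥0∞} (hz : z ≠ ∞) (hzk : z * ENNReal.ofReal κ < 1)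
    (h : ∀ x ∈ L, ∀ y ∈ L, star (weighted L (boost κ z) z A) x y ≠ ∞) :
    ∀ᶠ κ' in 𝓝 κ, ∀ x ∈ L, ∀ y ∈ L, star (weighted L (boost κ' z) z A) x y ≠ ∞ := by
  obtain ⟨c, hc, -, H⟩ := exists_forall_star_weighted_ne_top hL h
  have hlt : boost κ z < c * boost κ z := by
    conv_lhs => rw [← one_mul (boost κ z)]
    exact ENNReal.mul_lt_mul_left (boost_ne_zero h1) (boost_ne_top hzk) hc
  filter_upwards [(continuousAt_boost_left h1 hz).eventually (gt_mem_nhds hlt)] with κ' hk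
  refine H _ _ _ fun x hx y hy => ?_
  rw [← mul_assoc]
  gcongr

theorem star_weighted_ne_top_of_le {L : Set S} (hL : L.Finite) {A : InfMat S} {t t' z z' : ℝ≥0∞}
    (h : ∀ x ∈ L, ∀ y ∈ L, star (weighted L t z A) x y ≠ ∞)
    (hle : ∀ x ∈ L, ∀ y ∈ L, t' * returnMat L z' A x y ≤ t * returnMat L z A x y) :
    ∀ x ∈ L, ∀ y ∈ L, star (weighted L t' z' A) x y ≠ ∞ := by
  obtain ⟨c, hc, -, H⟩ := exists_forall_star_weighted_ne_top hL h
  exact H _ _ _ fun x hx y hy => (hle x hx y hy).trans (le_mul_of_one_le_left' hc.le)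

theorem one_le_inv_one_sub (a : ℝ≥0∞) : 1 ≤ (1 - a)⁻¹ := ENNReal.one_le_inv.2 tsub_le_self

theorem star_weighted_le_star_lazyMat (L : Set S) (κ : ℝ) (z : ℝ≥0∞) (A : InfMat S) :
    star (weighted L (boost κ z) z A) ≤ star (row (fun _ => z) (lazyMat L κ A)) := by
  intro x y
  rw [star_lazyMat]
  refine le_mul_of_one_le_right' ?_
  split_ifs
  · exact one_le_inv_one_sub _
  · rfl

theorem star_lazyMat_ne_top {L : Set S} {κ : ℝ} {z : ℝ≥0∞} {A : InfMat S}
    (hzk : z * ENNReal.ofReal κ < 1) {x y : S}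
    (h : star (weighted L (boost κ z) z A) x y ≠ ∞) :
    star (row (fun _ => z) (lazyMat L κ A)) x y ≠ ∞ := by
  rw [star_lazyMat]
  refine ENNReal.mul_ne_top h ?_
  split_ifs
  · exact ENNReal.inv_ne_top.2 (tsub_pos_of_lt hzk).ne'
  · exact ENNReal.one_ne_top

theorem mul_lt_one_of_star_ne_top {L : Set S} {κ : ℝ} {z : ℝ≥0∞} {A : InfMat S} {x : S}
    (hx : x ∈ L) (h : star (row (fun _ => z) (lazyMat L κ A)) x x ≠ ∞) :
    z * ENNReal.ofReal κ < 1 := by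
  by_contra! hc
  apply h
  rw [star_lazyMat, if_pos hx, tsub_eq_zero_of_le hc, ENNReal.inv_zero, ENNReal.mul_top]
  refine (lt_of_lt_of_le zero_lt_one ?_).ne'
  simpa using one_le_star (weighted L (boost κ z) z A) x x

theorem star_le_star_lazyMat {L : Set S} {κ : ℝ} (h0 : 0 ≤ κ) (h1 : κ < 1) {z : ℝ≥0∞} (hz : 1 ≤ z)
    (A : InfMat S) : star (row (fun _ => z) A) ≤ star (row (fun _ => z) (lazyMat L κ A)) := by
  refine le_trans ?_ (star_weighted_le_star_lazyMat L κ z A)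
  rw [← weighted_one L]
  exact star_mono (weighted_mono (one_le_boost h0 h1 hz) le_rfl le_rfl)

theorem star_lazyMat_mono {L : Set S} {κ κ' : ℝ} (h0 : 0 ≤ κ) (h : κ ≤ κ') (h1 : κ' < 1)
    {z : ℝ≥0∞} (hz : 1 < z) (hztop : z ≠ ∞) (A : InfMat S) :
    star (row (fun _ => z) (lazyMat L κ A)) ≤ star (row (fun _ => z) (lazyMat L κ' A)) := by
  intro x y
  rw [star_lazyMat, star_lazyMat]
  refine mul_le_mul' (star_mono (weighted_mono (boost_le_boost_left h0 h h1 hz hztop) le_rfl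
    le_rfl) x y) ?_
  split_ifs
  · gcongr
  · rfl

/-- `r` is the radius of convergence of the power series `∑ₙ (Aⁿ)(x, y) zⁿ`, for all `x, y`. -/
structure IsGreenRadius (A : InfMat S) (r : ℝ≥0∞) : Prop where
  ne_top : ∀ z < r, ∀ x y, star (row (fun _ => z) A) x y ≠ ∞
  eq_top : ∀ z, r < z → ∀ x y, star (row (fun _ => z) A) x y = ∞

theorem IsGreenRadius.radius_ne_top {A : InfMat S} {r : ℝ≥0∞} (h : A.IsGreenRadius r) (hA : A.Connected)
    {x y : S} (hxy : x ≠ y) : r ≠ ∞ := by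
  rintro rfl
  obtain ⟨m, hm⟩ := exists_pow_ne_zero (hA x y)
  obtain ⟨n, hn⟩ := exists_pow_ne_zero (hA y x)
  have hm0 : m ≠ 0 := by
    rintro rfl
    exact hm (by rw [pow_zero, one_apply_ne hxy])
  have hp : (A ^ (m + n)) x x ≠ 0 := by
    intro h0
    have := mul_apply_le (A ^ m) (A ^ n) x y x
    rw [← pow_add, h0, nonpos_iff_eq_zero] at this
    exact (mul_ne_zero hm hn) this
  set p := (A ^ (m + n)) x x
  -- At this radius the loops at x of length m + n already have weight at least 1.
  have hz : 1 + p⁻¹ < ∞ := ENNReal.add_lt_top.2 ⟨ENNReal.one_lt_top, ENNReal.inv_lt_top.2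
    (pos_iff_ne_zero.2 hp)⟩
  have h1 := star_ne_top_of_pow (h.ne_top _ hz x x) (n := m + n) (by omega)
  rw [row_const_pow, row_apply] at h1
  refine absurd h1 (not_lt.2 ?_)
  by_cases hpt : p = ∞
  · change 1 ≤ (1 + p⁻¹) ^ (m + n) * p
    rw [hpt, ENNReal.mul_top (by simp)]
    exact le_top
  calc 1 = p⁻¹ * p := (ENNReal.inv_mul_cancel hp hpt).symm
    _ ≤ (1 + p⁻¹) ^ (m + n) * p := by
        gcongr
        exact le_add_self.trans (le_self_pow₀ le_self_add (by omega))

section Lazy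

variable {A : InfMat S} {L : Set S} {κ κ' : ℝ} {R r : ℝ≥0∞}

theorem IsGreenRadius.lazy_le (hR : A.IsGreenRadius R)
    (h0 : 0 ≤ κ) (h1 : κ < 1) (hR1 : 1 ≤ R) (x : S) (hr : (lazyMat L κ A).IsGreenRadius r) :
    r ≤ R := by
  by_contra! hlt
  obtain ⟨z, hRz, hzr⟩ := exists_between hlt
  refine hr.ne_top z hzr x x (top_unique ?_)
  rw [← hR.eq_top z hRz x x]
  exact star_le_star_lazyMat h0 h1 (hR1.trans hRz.le) A x x

theorem IsGreenRadius.returnMat_ne_top (hR : A.IsGreenRadius R) {z : ℝ≥0∞} (hz : z < R) (x y : S) :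
    returnMat L z A x y ≠ ∞ :=
  ne_top_of_le_ne_top (hR.ne_top z hz x y) (returnMat_le_star L A z x y)

/-- If the Green function of the lazy version is finite inside the disc of convergence of that of
`A`, then it is also finite slightly further out. -/
theorem IsGreenRadius.exists_gt (hR : A.IsGreenRadius R) (hL : L.Finite)
    (h1 : κ < 1) {z : ℝ≥0∞} (hz0 : z ≠ 0) (hz : z < R) {x : S} (hx : x ∈ L)
    (h : ∀ u v, star (row (fun _ => z) (lazyMat L κ A)) u v ≠ ∞) :
    ∃ w, z < w ∧ star (row (fun _ => w) (lazyMat L κ A)) x x ≠ ∞ := by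
  obtain ⟨z₀, hzz₀, hz₀⟩ := exists_between hz
  have hzk := mul_lt_one_of_star_ne_top hx (h x x)
  have hc : Continuous fun w : ℝ≥0∞ => w * ENNReal.ofReal κ :=
    ENNReal.continuous_mul_const ENNReal.ofReal_ne_top
  have h2 := eventually_star_weighted_ne_top hL (A := A) h1 hzz₀ hz0
    (fun x _ y _ => hR.returnMat_ne_top hz₀ x y)
    (fun x _ y _ => ne_top_of_le_ne_top (h x y) (star_weighted_le_star_lazyMat L κ z A x y))
  have : (𝓝[>] z).NeBot := nhdsGT_neBot_of_exists_gt ⟨z₀, hzz₀⟩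
  obtain ⟨w, ⟨hw1, hw2⟩, hw3⟩ := ((h2.and (nhdsWithin_le_nhds
    (hc.continuousAt.eventually (gt_mem_nhds hzk)))).and self_mem_nhdsWithin).exists
  exact ⟨w, hw3, star_lazyMat_ne_top hw2 (hw1 x hx x hx)⟩

/-- At z = 1 the weight `boost` equals 1, so finiteness is inherited from A because R > 1, and then
extends slightly beyond 1. -/
theorem IsGreenRadius.one_lt_lazy (hR : A.IsGreenRadius R) (hA : A.Connected) (hL : L.Finite)
    (h0 : 0 ≤ κ) (h1 : κ < 1) (hR1 : 1 < R) {x : S} (hx : x ∈ L)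
    (hr : (lazyMat L κ A).IsGreenRadius r) : 1 < r := by
  have hb : boost κ 1 = 1 := by
    rw [boost, one_mul, one_sub_ofReal h0, ENNReal.inv_mul_cancel (by simpa using h1)
      ENNReal.ofReal_ne_top]
  have hfin : star (row (fun _ => 1) (lazyMat L κ A)) x x ≠ ∞ := by
    refine star_lazyMat_ne_top (by simpa using h1) ?_
    rw [hb, weighted_one]
    exact hR.ne_top 1 hR1 x x
  obtain ⟨w, hw, hwfin⟩ := hR.exists_gt hL h1 one_ne_zero hR1 hx
    ((hA.lazyMat h0 h1).star_ne_top one_ne_zero hfin)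
  by_contra! hle
  exact hwfin (hr.eq_top w (hle.trans_lt hw) x x)

theorem IsGreenRadius.star_lazyMat_eq_top (hR : A.IsGreenRadius R) (hA : A.Connected)
    (hL : L.Finite) (h0 : 0 ≤ κ) (h1 : κ < 1) {x : S} (hx : x ∈ L)
    (hr : (lazyMat L κ A).IsGreenRadius r) (hr0 : r ≠ 0) (hrR : r < R) (u v : S) :
    star (row (fun _ => r) (lazyMat L κ A)) u v = ∞ := by
  by_contra h
  obtain ⟨w, hw, hwfin⟩ := hR.exists_gt hL h1 hr0 hrR hx ((hA.lazyMat h0 h1).star_ne_top hr0 h)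
  exact hwfin (hr.eq_top w hw x x)

/-- A version that is less lazy has a finite Green function at the boundary. -/
theorem star_lazyMat_ne_top_of_lt (hA : A.Connected) (hL : L.Finite) (h0 : 0 ≤ κ) (h : κ < κ')
    (h1 : κ' < 1) (hr1 : 1 < r) (hrtop : r ≠ ∞) {x : S} (hx : x ∈ L)
    (hr : ∀ z < r, ∀ u v, star (row (fun _ => z) (lazyMat L κ' A)) u v ≠ ∞) (u v : S) :
    star (row (fun _ => r) (lazyMat L κ A)) u v ≠ ∞ := by
  have hr0 : r ≠ 0 := (zero_lt_one.trans hr1).ne'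
  have hk'0 : 0 ≤ κ' := h0.trans h.le
  have : (𝓝[<] r).NeBot := nhdsLT_neBot_of_exists_lt ⟨1, hr1⟩
  have hrk' : r * ENNReal.ofReal κ' ≤ 1 := by
    refine le_of_tendsto (x := 𝓝[<] r)
      ((ENNReal.continuous_mul_const ENNReal.ofReal_ne_top).continuousWithinAt (s := Iio r)) ?_
    filter_upwards [self_mem_nhdsWithin] with z hz
    exact (mul_lt_one_of_star_ne_top hx (hr z hz x x)).le
  have hrk : r * ENNReal.ofReal κ < 1 :=
    (ENNReal.mul_lt_mul_right hr0 hrtop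
      ((ENNReal.ofReal_lt_ofReal_iff (h0.trans_lt h)).2 h)).trans_le hrk'
  have hfinA : ∀ z < r, ∀ u v, star (row (fun _ => z) A) u v ≠ ∞ := by
    intro z hz u v
    obtain ⟨w, hw, hwr⟩ := exists_between (max_lt hz hr1)
    refine ne_top_of_le_ne_top (hr w hwr u v) ?_
    refine (star_row_const_mono ((le_max_left z 1).trans hw.le) A u v).trans ?_
    exact star_le_star_lazyMat hk'0 h1 ((le_max_right z 1).trans hw.le) A u v
  have hret : ∀ u ∈ L, ∀ v ∈ L, returnMat L r A u v ≠ ∞ := fun u hu v hv =>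
    hA.returnMat_ne_top hr0 hu hv fun z hz => hfinA z hz u u
  have hlt := boost_lt_boost_left h0 h h1 hr1 hrtop hrk
  -- The strict gain from extra laziness leaves room for a factor c > 1, spent below on replacing r
  -- by a nearby z < r.
  obtain ⟨c, hc, hcb⟩ : ∃ c : ℝ≥0∞, 1 < c ∧ c * boost κ r < boost κ' r := by
    have hcont : ContinuousAt (fun c : ℝ≥0∞ => c * boost κ r) 1 :=
      (ENNReal.continuous_mul_const (boost_ne_top hrk)).continuousAt
    have : (𝓝[>] (1 : ℝ≥0∞)).NeBot := nhdsGT_neBot_of_exists_gt ⟨2, by norm_num⟩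
    obtain ⟨c, hc, hc'⟩ := (((hcont.eventually (gt_mem_nhds
      (by simpa using hlt))).filter_mono nhdsWithin_le_nhds).and
      (eventually_mem_nhdsWithin (s := Ioi (1 : ℝ≥0∞)))).exists
    exact ⟨c, hc', hc⟩
  obtain ⟨z, ⟨hz1, hz2⟩, hz3⟩ := (((eventually_le_mul_returnMat hL hr0 hret hc).and
    (nhdsWithin_le_nhds ((continuous_boost κ').continuousAt.eventually
      (lt_mem_nhds hcb)))).and self_mem_nhdsWithin).exists
  have key : ∀ x ∈ L, ∀ y ∈ L, star (weighted L (boost κ r) r A) x y ≠ ∞ := by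
    refine star_weighted_ne_top_of_le hL (t := boost κ' z) (z := z) (fun x hx y hy =>
      ne_top_of_le_ne_top (hr z hz3 x y) (star_weighted_le_star_lazyMat L κ' z A x y)) ?_
    intro x hx y hy
    calc boost κ r * returnMat L r A x y ≤ boost κ r * (c * returnMat L z A x y) := by
          gcongr; exact hz1 x hx y hy
      _ = c * boost κ r * returnMat L z A x y := by ring
      _ ≤ boost κ' z * returnMat L z A x y := by gcongr
  exact (hA.lazyMat h0 (h.trans h1)).star_ne_top hr0 (star_lazyMat_ne_top hrk (key x hx x hx)) u v

end Lazy

end InfMat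

end

/-! ### First-return series of the lazy chain, and the passage back to P -/

section

open Filter Topology

namespace InfMat

variable {S : Type*} {A : InfMat S} {L : Set S} {κ κ' : ℝ} {R r z : ℝ≥0∞}

theorem kill_row_const (x : S) (z : ℝ≥0∞) (A : InfMat S) :
    kill x (row (fun _ => z) A) = row (({x}ᶜ : Set S).indicator fun _ => z) A := by
  rw [row_indicator, kill_row, kill]

theorem Connected.star_kill_ne_zero (hA : A.Connected) (u x : S) : star (kill x A) u x ≠ 0 := by
  have h1 := hA u x
  have hA1 : row (fun _ => 1) A = A := by ext; simp [row_apply]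
  have hk : kill x A = row (({x}ᶜ : Set S).indicator fun _ => 1) A := by
    rw [← kill_row_const, hA1]
  have h2 : star A = star (kill x A) * star (row (fun _ => 1) (returnMat {x} 1 A)) := by
    rw [hk, ← star_weighted, weighted_one, hA1]
  rw [h2] at h1
  obtain ⟨v, hv1, hv2⟩ := exists_of_mul_apply_ne_zero h1
  by_cases hvx : v = x
  · rwa [hvx] at hv1
  · rw [star_apply_of_row_eq_zero (fun y => ?_), one_apply_ne hvx] at hv2
    · exact absurd rfl hv2
    · rw [row_apply, returnMat_apply_of_notMem (by simpa using hvx), mul_zero]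

theorem returnMat_singleton_ne_zero (hA : A.Connected) {x y : S} (hxy : x ≠ y) (hz : z ≠ 0) :
    returnMat {x} z A x y ≠ 0 := by
  have h := hA.row_const hz x y
  rw [← star_returnMat_apply (mem_singleton x), star_eq_one_add_mul', add_apply,
    one_apply_ne hxy, zero_add] at h
  obtain ⟨v, -, hv⟩ := exists_of_mul_apply_ne_zero h
  by_cases hvx : v = x
  · rwa [hvx] at hv
  · exact absurd (returnMat_apply_of_notMem (by simpa using hvx) _ _ _) hv

/-- An infinite entry in row y ≠ x would enter the return series at x, through an excursion from x
via y back to x. -/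
theorem star_kill_ne_top (hA : A.Connected) {x : S} (hz : z ≠ 0)
    (h : returnMat {x} z A x x ≠ ∞) (y w : S) : star (kill x (row (fun _ => z) A)) y w ≠ ∞ := by
  set K := kill x (row (fun _ => z) A) with hK
  by_cases hxy : x = y
  · subst hxy
    rw [star_apply_of_row_eq_zero (fun u => kill_apply_self _ _ _)]
    rw [one_apply]; split_ifs <;> simp
  intro htop
  obtain ⟨l, hl⟩ := exists_pow_ne_zero ((hA.row_const hz).star_kill_ne_zero w x)
  have h1 : star K y x = ∞ := by
    rw [eq_top_iff]
    calc ∞ = star K y w * (K ^ l) w x := by rw [htop, ENNReal.top_mul hl]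
      _ ≤ star K y x := (mul_apply_le _ _ _ _ _).trans (star_mul_pow_le K l y x)
  have h2 := returnMat_singleton_ne_zero hA hxy hz
  rw [returnMat_singleton, mul_star] at h2
  obtain ⟨m, hm⟩ := not_forall.1 (mt ENNReal.tsum_eq_zero.2 h2)
  apply h
  rw [returnMat_singleton, eq_top_iff]
  calc ∞ = (row (fun _ => z) A * K ^ m) x y * star K y x := by rw [h1, ENNReal.mul_top hm]
    _ ≤ (row (fun _ => z) A * K ^ m * star K) x x := mul_apply_le _ _ _ _ _
    _ ≤ (row (fun _ => z) A * star K) x x := by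
      rw [mul_assoc]
      exact mul_le_mul'' le_rfl (pow_mul_star_le K m) x x

theorem kill_row_lazyMat (x : S) (L : Set S) (κ : ℝ) (z : ℝ≥0∞) (A : InfMat S) :
    kill x (row (fun _ => z) (lazyMat L κ A)) =
      row (fun _ => z) (lazyMat (L \ {x}) κ (kill x A)) := by
  rw [kill_row, kill_lazyMat]

/-- The return series of the lazy version has a strictly larger radius of convergence than its
Green function, if the latter has a smaller radius of convergence than that of `A`. -/
theorem IsGreenRadius.exists_returnMat_lazyMat_ne_top (hR : A.IsGreenRadius R) (hA : A.Connected)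
    (hL : L.Finite) (h0 : 0 ≤ κ) (h1 : κ < 1) {x : S} (hx : x ∈ L) (hr0 : r ≠ 0) (hrR : r < R)
    (hr : ∀ z < r, ∀ u v, star (row (fun _ => z) (lazyMat L κ A)) u v ≠ ∞) :
    ∃ w, r < w ∧ w < R ∧ returnMat {x} w (lazyMat L κ A) x x ≠ ∞ := by
  have hQ := hA.lazyMat (L := L) h0 h1
  have hU : returnMat {x} r (lazyMat L κ A) x x ≠ ∞ :=
    hQ.returnMat_ne_top hr0 (mem_singleton x) (mem_singleton x) fun z hz => hr z hz x x
  -- The first-return series is finite at r although the Green function need not be; hence the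
  -- perturbation is applied to the chain killed at x.
  have hKfin : ∀ u ∈ L, ∀ v ∈ L, star (weighted L (boost κ r) r (kill x A)) u v ≠ ∞ := by
    intro u _ v _
    rw [← weighted_kill]
    refine ne_top_of_le_ne_top ?_ (star_weighted_le_star_lazyMat (L \ {x}) κ r (kill x A) u v)
    rw [← kill_row_lazyMat]
    exact star_kill_ne_top hQ hr0 hU u v
  obtain ⟨z₀, hrz₀, hz₀R⟩ := exists_between hrR
  have hAk : ∀ w < R, ∀ u v, star (row (fun _ => w) (kill x A)) u v ≠ ∞ := fun w hw u v =>
    ne_top_of_le_ne_top (hR.ne_top w hw u v)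
      (star_mono (row_mono (fun _ => le_rfl) (kill_le x A)) u v)
  have hret : ∀ u ∈ L, ∀ v ∈ L, returnMat L z₀ (kill x A) u v ≠ ∞ := fun u _ v _ =>
    ne_top_of_le_ne_top (hAk z₀ hz₀R u v) (returnMat_le_star _ _ _ _ _)
  have : (𝓝[>] r).NeBot := nhdsGT_neBot_of_exists_gt ⟨z₀, hrz₀⟩
  obtain ⟨w, hw, hrw, hwz₀⟩ := ((eventually_star_weighted_ne_top hL h1 hrz₀ hr0 hret hKfin).and
    (Ioo_mem_nhdsGT hrz₀)).exists
  have hwR := hwz₀.trans hz₀R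
  refine ⟨w, hrw, hwR, ?_⟩
  have hstar : ∀ u, star (row (fun _ => w) (lazyMat (L \ {x}) κ (kill x A))) u x =
      star (weighted L (boost κ w) w (kill x A)) u x := by
    intro u
    rw [star_lazyMat, weighted_kill, if_neg (by simp), mul_one]
  rw [returnMat_singleton, kill_row_lazyMat, mul_apply]
  simp only [hstar]
  set N := star (weighted L (boost κ w) w (kill x A)) with hN
  -- The first step either holds at x or follows A. In the second case the path is cut at its visits
  -- to L, leaving a finite sum of finite terms.
  have hle : ∑' s, row (fun _ => w) (lazyMat L κ A) x s * N s x ≤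
      w * N x x + (row (fun _ => w) A * N) x x := by
    have h2 : (row (fun _ => w) (1 : InfMat S) * N) x x = w * N x x := by
      rw [row_mul, one_mul, row_apply]
    rw [← h2, ← add_apply, ← add_mul]
    refine mul_le_mul'' (fun u v => ?_) le_rfl x x
    simp only [row_apply, add_apply, ← mul_add, lazyMat]
    gcongr
    · split_ifs
      · exact mul_le_of_le_one_left' (ENNReal.ofReal_le_one.2 h1.le)
      · simp
    · split_ifs
      · exact mul_le_of_le_one_left' (ENNReal.ofReal_le_one.2 (by linarith))
      · simp
  refine ne_top_of_le_ne_top (ENNReal.add_ne_top.2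
    ⟨ENNReal.mul_ne_top hwR.ne_top (hw x hx x hx), ?_⟩) hle
  rw [hN, star_weighted, ← mul_assoc, mul_apply]
  set B := row (fun _ => w) A * star (row (Lᶜ.indicator fun _ => w) (kill x A)) with hB
  have hBfin : ∀ s, B x s ≠ ∞ := fun s => by
    refine ne_top_of_le_ne_top (hR.ne_top w hwR x s) ?_
    refine le_trans (mul_le_mul'' le_rfl (star_mono ?_) x s) (mul_star_le_star _ x s)
    exact row_mono (fun u => indicator_le_self _ _ _) (kill_le x A)
  rw [tsum_eq_sum (s := hL.toFinset)]
  · refine ENNReal.sum_ne_top.2 fun s hs => ENNReal.mul_ne_top (hBfin s) ?_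
    rw [hL.mem_toFinset] at hs
    rw [← star_weighted_apply hs]
    exact hw s hs x hx
  · intro s hs
    rw [hL.mem_toFinset] at hs
    have hsx : s ≠ x := fun e => hs (e ▸ hx)
    rw [star_apply_of_row_eq_zero (fun u => ?_), one_apply_ne hsx, mul_zero]
    rw [row_apply, returnMat_apply_of_notMem hs, mul_zero]

/-- Otherwise the perturbation argument with L = {x} and κ = 0 would continue the Green function,
finite at R, beyond its radius. -/
theorem IsGreenRadius.returnMat_eq_top (hR : A.IsGreenRadius R) (hR0 : R ≠ 0)
    (h : ∀ u v, star (row (fun _ => R) A) u v ≠ ∞) (hz : R < z) (x : S) :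
    returnMat {x} z A x x = ∞ := by
  by_contra hne
  have hb : ∀ w, boost 0 w = 1 := fun w => by simp [boost]
  have : (𝓝[>] R).NeBot := nhdsGT_neBot_of_exists_gt ⟨z, hz⟩
  obtain ⟨w, hw, hw'⟩ := ((eventually_star_weighted_ne_top (finite_singleton x) (κ := 0) one_pos hz
    hR0 (by rintro u rfl v rfl; exact hne) (by
      rintro u rfl v rfl
      rw [hb, weighted_one]
      exact h _ _)).and (Ioo_mem_nhdsGT hz)).exists
  refine hw x rfl x rfl ?_
  rw [hb, weighted_one]
  exact hR.eq_top w hw'.1 x x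

/-- Laziness costs at most a factor 1 - κ on the first step, and for z ≥ 1 it only increases the
Green function of the killed chain. -/
theorem IsGreenRadius.returnMat_lazyMat_eq_top (hR : A.IsGreenRadius R) (hR1 : 1 ≤ R)
    (h : ∀ u v, star (row (fun _ => R) A) u v ≠ ∞) (h0 : 0 ≤ κ) (h1 : κ < 1) (hz : R < z)
    (x : S) : returnMat {x} z (lazyMat L κ A) x x = ∞ := by
  have hU := hR.returnMat_eq_top (zero_lt_one.trans_le hR1).ne' h hz x
  have hle : (row (fun _ => ENNReal.ofReal (1 - κ)) (row (fun _ => z) A) *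
      star (kill x (row (fun _ => z) A))) x x ≤ returnMat {x} z (lazyMat L κ A) x x := by
    rw [returnMat_singleton]
    refine mul_le_mul'' ?_ ?_ x x
    · intro u v
      simp only [row_apply, mul_left_comm _ z]
      gcongr
      exact row_le_lazyMat h0 A u v
    · rw [kill_row_lazyMat, kill_row]
      exact star_le_star_lazyMat h0 h1 (hR1.trans hz.le) _
  rw [row_mul, row_apply, ← returnMat_singleton, hU, ENNReal.mul_top (by simpa using h1)] at hle
  exact top_unique hle

theorem tsum_pow_le_one (h : ∀ x, ∑' y, A x y ≤ 1) (n : ℕ) (x : S) : ∑' y, (A ^ n) x y ≤ 1 := by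
  induction n generalizing x with
  | zero =>
    rw [pow_zero, tsum_eq_single x (fun y hy => one_apply_ne hy.symm), one_apply_self]
  | succ n ih =>
    simp only [pow_succ', mul_apply]
    rw [ENNReal.tsum_comm]
    simp only [ENNReal.tsum_mul_left]
    refine le_trans (ENNReal.tsum_le_tsum fun s => ?_) (h x)
    exact mul_le_of_le_one_right' (ih s)

theorem tsum_lazyMat_le_one (h : ∀ x, ∑' y, A x y ≤ 1) (h0 : 0 ≤ κ) (h1 : κ ≤ 1) (x : S) :
    ∑' y, lazyMat L κ A x y ≤ 1 := by
  have hone : ∑' y, (1 : InfMat S) x y = 1 := by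
    rw [tsum_eq_single x (fun y hy => one_apply_ne hy.symm), one_apply_self]
  simp only [lazyMat, add_apply, row_apply, ENNReal.tsum_add, ENNReal.tsum_mul_left, hone, mul_one]
  split_ifs
  · calc ENNReal.ofReal κ + ENNReal.ofReal (1 - κ) * ∑' y, A x y
        ≤ ENNReal.ofReal κ + ENNReal.ofReal (1 - κ) * 1 := by gcongr; exact h x
      _ = 1 := by
        rw [mul_one, ← ENNReal.ofReal_add h0 (by linarith)]
        simp
  · simpa using h x

end InfMat

open InfMat

variable {S : Type*} {P : S → S → ℝ} {L : Set S} {κ : ℝ}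

/-- The supremum defining the spectral radius gives convergence of all entries below its inverse,
and divergence of some entry beyond it; connectedness spreads the divergence to all entries. -/
theorem isGreenRadius (hP : ∀ x y, 0 ≤ P x y) (hA : (probMat P).Connected)
    (hsum : ∀ x, ∑' y, probMat P x y ≤ 1) :
    (probMat P).IsGreenRadius (spectralRadius P)⁻¹ where
  ne_top z hz x y := by
    rw [← green_eq hP]
    refine tsum_ne_top_of_lt_convRadius (fun n => ?_) ?_
    · rw [stepProb_eq hP]
      exact ENNReal.ne_top_of_tsum_ne_top
        (ne_top_of_le_ne_top ENNReal.one_ne_top (tsum_pow_le_one hsum n x)) y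
    · rw [← ENNReal.inv_lt_inv]
      refine lt_of_le_of_lt ?_ (ENNReal.lt_inv_iff_lt_inv.1 hz)
      exact le_iSup₂ (f := fun x y => (convRadius (stepProb P x y))⁻¹) x y
  eq_top z hz x y := by
    rw [ENNReal.inv_lt_iff_inv_lt, spectralRadius] at hz
    obtain ⟨u, hu⟩ := lt_iSup_iff.1 hz
    obtain ⟨v, huv⟩ := lt_iSup_iff.1 hu
    rw [ENNReal.inv_lt_inv] at huv
    obtain ⟨w, hw, hwz⟩ := exists_between huv
    by_contra h
    have h1 := hA.star_ne_top (bot_le.trans_lt hw).ne' (x := x) (y := y)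
      (ne_top_of_le_ne_top h (star_row_const_mono hwz.le _ x y)) u v
    rw [← green_eq hP] at h1
    exact (le_convRadius hwz.ne_top h1).not_gt hw

theorem radiusU_eq_of (hP : ∀ x y, 0 ≤ P x y) (hsum : ∀ x, ∑' y, probMat P x y ≤ 1) {x : S}
    {R : ℝ≥0∞} (hlt : ∀ z < R, returnMat {x} z (probMat P) x x ≠ ∞)
    (hgt : ∀ z, R < z → returnMat {x} z (probMat P) x x = ∞) : radiusU P x x = R := by
  apply le_antisymm
  · by_contra! h
    obtain ⟨z, hz, hz'⟩ := exists_between h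
    refine tsum_ne_top_of_lt_convRadius (fun n => ?_) hz' ((tsum_firstHitProb hP x z).trans
      (hgt z hz))
    cases n with
    | zero => rw [firstHitProb_zero]; exact ENNReal.zero_ne_top
    | succ n =>
      rw [firstHitProb_succ hP]
      refine ne_top_of_le_ne_top (ENNReal.ne_top_of_tsum_ne_top
        (ne_top_of_le_ne_top ENNReal.one_ne_top (tsum_pow_le_one hsum (n + 1) x)) x) ?_
      rw [pow_succ']
      exact mul_le_mul'' le_rfl (pow_mono (kill_le x _) n) x x
  · refine le_of_forall_lt_imp_le_of_dense fun z hz => ?_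
    refine le_convRadius hz.ne_top ?_
    rw [tsum_firstHitProb hP]
    exact hlt z hz

theorem lt_radiusU (hP : ∀ x y, 0 ≤ P x y) {x : S} {r w : ℝ≥0∞} (hrw : r < w) (hw : w ≠ ∞)
    (h : returnMat {x} w (probMat P) x x ≠ ∞) : r < radiusU P x x := by
  refine hrw.trans_le (le_convRadius hw ?_)
  rwa [← tsum_firstHitProb hP] at h

theorem lazy_nonneg (hP : ∀ x y, 0 ≤ P x y) (h0 : 0 ≤ κ) (h1 : κ ≤ 1) (x y : S) :
    0 ≤ lazy P L κ x y := by
  have := hP x y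
  have := hP x x
  have : 0 ≤ 1 - κ := by linarith
  unfold lazy
  split_ifs <;> positivity

theorem probMat_lazy (hP : ∀ x y, 0 ≤ P x y) (h0 : 0 ≤ κ) (h1 : κ ≤ 1) :
    probMat (lazy P L κ) = lazyMat L κ (probMat P) := by
  have h1' : 0 ≤ 1 - κ := by linarith
  ext x y
  by_cases hx : x ∈ L
  · by_cases hxy : x = y
    · subst hxy
      simp only [probMat, lazy, lazyMat, add_apply, row_apply, hx, if_true, one_apply_self, mul_one]
      rw [ENNReal.ofReal_add h0 (mul_nonneg h1' (hP x x)), ENNReal.ofReal_mul h1']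
    · simp [probMat, lazy, lazyMat, row_apply, hx, hxy, one_apply_ne hxy, ENNReal.ofReal_mul h1']
  · simp [probMat, lazy, lazyMat, row_apply, hx]

end

/-! ### Spectral radius and recurrence of lazy versions -/

section

open Filter Topology InfMat

variable {S : Type*} {P : S → S → ℝ} {L : Set S} {κ κ' : ℝ}

theorem IsTransitionProb.tsum_le_one (hP : IsTransitionProb P) (x : S) :
    ∑' y, probMat P x y ≤ 1 := by
  unfold probMat
  rw [← ENNReal.ofReal_tsum_of_nonneg (hP.nonneg x) (hP.hasSum_one x).summable,
    (hP.hasSum_one x).tsum_eq, ENNReal.ofReal_one]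

theorem IsIrreducible.connected (hP : IsTransitionProb P) (h : IsIrreducible P) :
    (probMat P).Connected := by
  intro x y h0
  obtain ⟨n, hn⟩ := h x y
  rw [stepProb_eq hP.nonneg] at hn
  exact absurd (hn.trans_le (pow_le_star _ n x y)) (by simp [h0])

theorem isGreenRadius_lazy (hP : IsTransitionProb P) (h : IsIrreducible P) (hκ : κ ∈ Ico 0 1) :
    (lazyMat L κ (probMat P)).IsGreenRadius (spectralRadius (lazy P L κ))⁻¹ := by
  rw [← probMat_lazy hP.nonneg hκ.1 hκ.2.le]
  refine isGreenRadius (lazy_nonneg hP.nonneg hκ.1 hκ.2.le) ?_ ?_ <;>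
    rw [probMat_lazy hP.nonneg hκ.1 hκ.2.le]
  · exact (h.connected hP).lazyMat hκ.1 hκ.2
  · exact tsum_lazyMat_le_one hP.tsum_le_one hκ.1 hκ.2.le

theorem green_lazy_eq (hP : IsTransitionProb P) (hκ : κ ∈ Ico 0 1) (x y : S) (z : ℝ≥0∞) :
    green (lazy P L κ) x y z = star (row (fun _ => z) (lazyMat L κ (probMat P))) x y := by
  rw [green_eq (lazy_nonneg hP.nonneg hκ.1 hκ.2.le), probMat_lazy hP.nonneg hκ.1 hκ.2.le]

theorem one_lt_inv_spectralRadius_lazy (hP : IsTransitionProb P) (hirr : IsIrreducible P)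
    (hρ : spectralRadius P < 1) (hfin : L.Finite) (hne : L.Nonempty) (hκ : κ ∈ Ico 0 1) :
    1 < (spectralRadius (lazy P L κ))⁻¹ := by
  obtain ⟨x, hx⟩ := hne
  exact (isGreenRadius hP.nonneg (hirr.connected hP) hP.tsum_le_one).one_lt_lazy
    (hirr.connected hP) hfin hκ.1 hκ.2 (ENNReal.one_lt_inv.2 hρ) hx (isGreenRadius_lazy hP hirr hκ)

theorem spectralRadius_le_lazy (hP : IsTransitionProb P) (hirr : IsIrreducible P)
    (hρ : spectralRadius P < 1) (hne : L.Nonempty) (hκ : κ ∈ Ico 0 1) :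
    spectralRadius P ≤ spectralRadius (lazy P L κ) := by
  obtain ⟨x, hx⟩ := hne
  exact ENNReal.inv_le_inv.1 ((isGreenRadius hP.nonneg (hirr.connected hP) hP.tsum_le_one).lazy_le
    hκ.1 hκ.2 (ENNReal.one_lt_inv.2 hρ).le x (isGreenRadius_lazy hP hirr hκ))

theorem isRhoRecurrent_lazy_of_lt (hP : IsTransitionProb P) (hirr : IsIrreducible P)
    (hρ : spectralRadius P < 1) (hfin : L.Finite) (hne : L.Nonempty) (hκ : κ ∈ Ico 0 1)
    (hlt : spectralRadius P < spectralRadius (lazy P L κ)) : IsRhoRecurrent (lazy P L κ) := by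
  have h1 := one_lt_inv_spectralRadius_lazy hP hirr hρ hfin hne hκ
  obtain ⟨x, hx⟩ := hne
  intro u v
  rw [green_lazy_eq hP hκ]
  exact (isGreenRadius hP.nonneg (hirr.connected hP) hP.tsum_le_one).star_lazyMat_eq_top
    (hirr.connected hP) hfin hκ.1 hκ.2 hx (isGreenRadius_lazy hP hirr hκ)
    (zero_lt_one.trans h1).ne' (ENNReal.inv_lt_inv.2 hlt) u v

theorem isStrictlyRhoRecurrent_lazy_of_lt (hP : IsTransitionProb P) (hirr : IsIrreducible P)
    (hρ : spectralRadius P < 1) (hfin : L.Finite) (hne : L.Nonempty) (hκ : κ ∈ Ico 0 1)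
    (hlt : spectralRadius P < spectralRadius (lazy P L κ)) :
    IsStrictlyRhoRecurrent (lazy P L κ) := by
  have h1 := one_lt_inv_spectralRadius_lazy hP hirr hρ hfin hne hκ
  refine ⟨isRhoRecurrent_lazy_of_lt hP hirr hρ hfin hne hκ hlt, fun h => ?_⟩
  obtain ⟨x, hx⟩ := hne
  obtain ⟨w, hw, hwR, hU⟩ :=
    (isGreenRadius hP.nonneg (hirr.connected hP) hP.tsum_le_one).exists_returnMat_lazyMat_ne_top
      (hirr.connected hP) hfin hκ.1 hκ.2 hx (zero_lt_one.trans h1).ne' (ENNReal.inv_lt_inv.2 hlt)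
      (isGreenRadius_lazy hP hirr hκ).ne_top
  rw [← probMat_lazy hP.nonneg hκ.1 hκ.2.le] at hU
  exact (lt_radiusU (lazy_nonneg hP.nonneg hκ.1 hκ.2.le) hw hwR.ne_top hU).ne' (h x)

/-- A radius at which the Green function is infinite is strictly larger than the radius of
convergence of any lazier version. -/
theorem spectralRadius_lt_lazy (hP : IsTransitionProb P) (hirr : IsIrreducible P)
    (hfin : L.Finite) (hne : L.Nonempty) {r : ℝ≥0∞} (hr1 : 1 < r) (hrtop : r ≠ ∞)
    (h0 : 0 ≤ κ) (h : κ < κ') (h1 : κ' < 1) {x y : S}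
    (hinf : star (row (fun _ => r) (lazyMat L κ (probMat P))) x y = ∞) :
    r⁻¹ < spectralRadius (lazy P L κ') := by
  by_contra! hle
  have hle' : r ≤ (spectralRadius (lazy P L κ'))⁻¹ := ENNReal.le_inv_iff_le_inv.1 hle
  obtain ⟨u, hu⟩ := hne
  exact star_lazyMat_ne_top_of_lt (hirr.connected hP) hfin h0 h h1 hr1 hrtop hu
    (fun z hz => (isGreenRadius_lazy hP hirr ⟨h0.trans h.le, h1⟩).ne_top z (hz.trans_le hle')) x y
    hinf

end

/-! ### The critical laziness -/

section

open Filter Topology InfMat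

variable {S : Type*} {P : S → S → ℝ} {L : Set S} {κ κ' : ℝ}

theorem inv_spectralRadius_ne_top [Nontrivial S] (hP : IsTransitionProb P)
    (hirr : IsIrreducible P) : (spectralRadius P)⁻¹ ≠ ∞ := by
  obtain ⟨x, y, hxy⟩ := exists_pair_ne S
  exact (isGreenRadius hP.nonneg (hirr.connected hP) hP.tsum_le_one).radius_ne_top (hirr.connected hP) hxy

theorem inv_spectralRadius_lazy_ne_top [Nontrivial S] (hP : IsTransitionProb P)
    (hirr : IsIrreducible P) (hκ : κ ∈ Ico 0 1) : (spectralRadius (lazy P L κ))⁻¹ ≠ ∞ := by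
  obtain ⟨x, y, hxy⟩ := exists_pair_ne S
  exact (isGreenRadius_lazy hP hirr hκ).radius_ne_top ((hirr.connected hP).lazyMat hκ.1 hκ.2) hxy

theorem lazyMat_zero (L : Set S) (A : InfMat S) : lazyMat L 0 A = A := by
  ext x y; simp [lazyMat, row_apply]

/-- The spectral radius strictly increases from any laziness at which the lazy version is
rho-recurrent. -/
theorem IsRhoRecurrent.spectralRadius_lazy_lt [Nontrivial S] (hP : IsTransitionProb P)
    (hirr : IsIrreducible P) (hρ : spectralRadius P < 1) (hfin : L.Finite) (hne : L.Nonempty)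
    (h0 : 0 ≤ κ) (h : κ < κ') (h1 : κ' < 1) (hrec : IsRhoRecurrent (lazy P L κ)) :
    spectralRadius (lazy P L κ) < spectralRadius (lazy P L κ') := by
  have hκ : κ ∈ Ico 0 1 := ⟨h0, h.trans h1⟩
  obtain ⟨x, hx⟩ := hne
  have hinf := hrec x x
  rw [green_lazy_eq hP hκ] at hinf
  have := spectralRadius_lt_lazy hP hirr hfin ⟨x, hx⟩
    (one_lt_inv_spectralRadius_lazy hP hirr hρ hfin ⟨x, hx⟩ hκ)
    (inv_spectralRadius_lazy_ne_top hP hirr hκ) h0 h h1 hinf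
  rwa [inv_inv] at this

theorem lazy_zero (P : S → S → ℝ) (L : Set S) : lazy P L 0 = P := by
  funext x y
  unfold lazy
  split_ifs with _ h
  · rw [h]; simp
  · simp
  · rfl

theorem exists_isCriticalValue [Nontrivial S] (hP : IsTransitionProb P)
    (hirr : IsIrreducible P) (hρ : spectralRadius P < 1) (hfin : L.Finite) (hne : L.Nonempty)
    (htr : IsRhoTransient P) : ∃ κc, IsCriticalValue P L κc := by
  obtain ⟨x, hx⟩ := id hne
  set A := probMat P with hAdef
  set R := (spectralRadius P)⁻¹ with hRdef
  have hA : A.Connected := hirr.connected hP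
  have hR1 : 1 < R := ENNReal.one_lt_inv.2 hρ
  have hR0 : R ≠ 0 := (zero_lt_one.trans hR1).ne'
  have hRtop : R ≠ ∞ := inv_spectralRadius_ne_top hP hirr
  set F : ℝ → Prop := fun κ => ∀ u v, star (row (fun _ => R) (lazyMat L κ A)) u v ≠ ∞ with hF
  have hF0 : F 0 := fun u v => by
    rw [lazyMat_zero, ← green_eq hP.nonneg]
    exact (htr u v).ne
  have hmono : ∀ κ κ', 0 ≤ κ → κ ≤ κ' → κ' < 1 → F κ' → F κ := fun κ κ' h0 h h1 hF' u v =>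
    ne_top_of_le_ne_top (hF' u v) (star_lazyMat_mono h0 h h1 hR1 hRtop A u v)
  have hlt1 : ∀ κ, F κ → R * ENNReal.ofReal κ < 1 := fun κ h =>
    mul_lt_one_of_star_ne_top hx (h x x)
  have hopen : ∀ κ ∈ Ico (0 : ℝ) 1, F κ → ∃ κ', κ < κ' ∧ κ' < 1 ∧ F κ' := by
    intro κ hκ hFκ
    have h1 := eventually_star_weighted_ne_top_left hfin hκ.2 hRtop (hlt1 κ hFκ)
      (fun u _ v _ => ne_top_of_le_ne_top (hFκ u v) (star_weighted_le_star_lazyMat L κ R A u v))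
    have h2 : ∀ᶠ κ' in 𝓝 κ, R * ENNReal.ofReal κ' < 1 :=
      ((ENNReal.continuous_const_mul hRtop).comp ENNReal.continuous_ofReal).continuousAt.eventually
        (gt_mem_nhds (hlt1 κ hFκ))
    obtain ⟨κ', ⟨h1', h2'⟩, h3, h4⟩ := (((h1.and h2).filter_mono nhdsWithin_le_nhds).and
      (Ioo_mem_nhdsGT hκ.2)).exists
    exact ⟨κ', h3, h4, (hA.lazyMat (hκ.1.trans h3.le) h4).star_ne_top hR0
      (star_lazyMat_ne_top h2' (h1' x hx x hx))⟩
  have hsr : ∀ κ ∈ Ico (0 : ℝ) 1, F κ →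
      spectralRadius (lazy P L κ) = spectralRadius P ∧ IsRhoTransient (lazy P L κ) := by
    intro κ hκ hFκ
    have heq : spectralRadius (lazy P L κ) = spectralRadius P := by
      refine le_antisymm ?_ (spectralRadius_le_lazy hP hirr hρ hne hκ)
      by_contra! hlt
      exact hFκ x x ((isGreenRadius_lazy hP hirr hκ).eq_top R (ENNReal.inv_lt_inv.2 hlt) x x)
    refine ⟨heq, fun u v => ?_⟩
    rw [heq, green_lazy_eq hP hκ]
    exact (hFκ u v).lt_top
  set T : Set ℝ := {κ | κ ∈ Ico (0 : ℝ) 1 ∧ F κ} with hT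
  have hT0 : (0 : ℝ) ∈ T := ⟨⟨le_rfl, one_pos⟩, hF0⟩
  have hbdd : BddAbove T := ⟨1, fun κ h => h.1.2.le⟩
  set κc := sSup T with hκc
  -- By openness the supremum is not attained, so the Green function at R is already infinite at κc.
  have hTlt : ∀ κ ∈ T, κ < κc := by
    intro κ hκ
    obtain ⟨κ', h1, h2, h3⟩ := hopen κ hκ.1 hκ.2
    exact h1.trans_le (le_csSup hbdd ⟨⟨hκ.1.1.trans h1.le, h2⟩, h3⟩)
  have hpos : 0 < κc := hTlt 0 hT0
  have hbelow : ∀ κ ∈ Ico 0 κc, κ ∈ T := by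
    intro κ hκ
    obtain ⟨κ', h1, h2⟩ := exists_lt_of_lt_csSup ⟨0, hT0⟩ hκ.2
    exact ⟨⟨hκ.1, h2.trans h1.1.2⟩, hmono κ κ' hκ.1 h2.le h1.1.2 h1.2⟩
  have hRκc : R * ENNReal.ofReal κc ≤ 1 := by
    refine le_of_tendsto (x := 𝓝[<] κc) (((ENNReal.continuous_const_mul hRtop).comp
      ENNReal.continuous_ofReal).continuousWithinAt (s := Iio κc)) ?_
    filter_upwards [Ioo_mem_nhdsLT hpos] with κ hκ
    exact (hlt1 κ (hbelow κ ⟨hκ.1.le, hκ.2⟩).2).le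
  have hmul : ∀ z < R, z * ENNReal.ofReal κc < 1 := fun z hz =>
    (ENNReal.mul_lt_mul_left (by simpa using hpos) ENNReal.ofReal_ne_top hz).trans_le hRκc
  have hκc1 : κc < 1 := by
    have := hmul 1 hR1
    rwa [one_mul, ENNReal.ofReal_lt_one] at this
  have hcrit : spectralRadius (lazy P L κc) = spectralRadius P := by
    refine le_antisymm ?_ (spectralRadius_le_lazy hP hirr hρ hne ⟨hpos.le, hκc1⟩)
    by_contra! hlt
    have hr := isGreenRadius_lazy (L := L) hP hirr ⟨hpos.le, hκc1⟩
    obtain ⟨z, hz, hzR⟩ := exists_between (ENNReal.inv_lt_inv.2 hlt)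
    -- Lowering R to z makes room to lower κc to some κ in T: the weight at (κc, z) lies below that
    -- at (κ, R), where the series is finite.
    have hb := boost_lt_boost_right hpos hκc1 hzR (hmul z hzR)
    obtain ⟨κ, hκ, hκ0, hκκc⟩ := ((((continuousAt_boost_left hκc1 hRtop).eventually
      (lt_mem_nhds hb)).filter_mono nhdsWithin_le_nhds).and (Ioo_mem_nhdsLT hpos)).exists
    have hFκ := (hbelow κ ⟨hκ0.le, hκκc⟩).2
    have := star_weighted_ne_top_of_le hfin (t' := boost κc z) (z' := z)
      (fun u _ v _ => ne_top_of_le_ne_top (hFκ u v) (star_weighted_le_star_lazyMat L κ R A u v))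
      (fun u _ v _ => mul_le_mul' hκ.le (returnMat_mono L A hzR.le u v)) x hx x hx
    exact star_lazyMat_ne_top (hmul z hzR) this (hr.eq_top z hz x x)
  have hinf : ∀ κ ∈ Ico κc 1, ∀ u v, star (row (fun _ => R) (lazyMat L κ A)) u v = ∞ := by
    intro κ hκ u v
    by_contra h
    have h0 := hpos.le.trans hκ.1
    exact (hTlt κ ⟨⟨h0, hκ.2⟩, (hA.lazyMat h0 hκ.2).star_ne_top hR0 h⟩).not_ge hκ.1
  have habove : ∀ κ ∈ Ico κc 1, IsRhoRecurrent (lazy P L κ) := by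
    intro κ hκ
    have hκ' : κ ∈ Ico (0 : ℝ) 1 := ⟨hpos.le.trans hκ.1, hκ.2⟩
    rcases (spectralRadius_le_lazy hP hirr hρ hne hκ').eq_or_lt with heq | hlt
    · intro u v
      rw [← heq, green_lazy_eq hP hκ']
      exact hinf κ hκ u v
    · exact isRhoRecurrent_lazy_of_lt hP hirr hρ hfin hne hκ' hlt
  exact ⟨κc, ⟨hpos, hκc1⟩, fun κ hκ => hsr κ (hbelow κ hκ).1 (hbelow κ hκ).2,
    fun κ hκ κ' hκ' h => (habove κ hκ).spectralRadius_lazy_lt hP hirr hρ hfin hne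
      (hpos.le.trans hκ.1) h hκ'.2, hcrit, habove⟩

theorem IsRhoTransient.not_isRhoRecurrent [Nonempty S] (h : IsRhoTransient P) :
    ¬ IsRhoRecurrent P := fun h' => by
  obtain ⟨x⟩ := ‹Nonempty S›
  exact (h x x).ne (h' x x)

/-- At the smaller of two distinct critical values the chain would be both recurrent and transient.
-/
theorem IsCriticalValue.eq [Nonempty S] {κ₁ κ₂ : ℝ} (h₁ : IsCriticalValue P L κ₁)
    (h₂ : IsCriticalValue P L κ₂) : κ₁ = κ₂ := by
  have key : ∀ {a b : ℝ}, IsCriticalValue P L a → IsCriticalValue P L b → ¬ a < b :=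
    fun ha hb hab => (hb.below _ ⟨ha.mem.1.le, hab⟩).2.not_isRhoRecurrent
      (ha.above _ ⟨le_rfl, ha.mem.2⟩)
  exact le_antisymm (not_lt.1 (key h₂ h₁)) (not_lt.1 (key h₁ h₂))

theorem IsCriticalValue.isCriticallyRhoRecurrent {κc : ℝ} (hP : IsTransitionProb P)
    (hirr : IsIrreducible P) (hρ : spectralRadius P < 1) (htr : IsRhoTransient P)
    (h : IsCriticalValue P L κc) : IsCriticallyRhoRecurrent (lazy P L κc) := by
  have hκ : κc ∈ Ico (0 : ℝ) 1 := ⟨h.mem.1.le, h.mem.2⟩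
  have hR := isGreenRadius hP.nonneg (hirr.connected hP) hP.tsum_le_one
  have hQ := probMat_lazy (L := L) hP.nonneg hκ.1 hκ.2.le
  refine ⟨h.above _ ⟨le_rfl, h.mem.2⟩, fun x => ?_⟩
  refine radiusU_eq_of (lazy_nonneg hP.nonneg hκ.1 hκ.2.le) ?_ ?_ ?_ <;> rw [hQ]
  · exact tsum_lazyMat_le_one hP.tsum_le_one hκ.1 hκ.2.le
  · exact fun z hz => (isGreenRadius_lazy hP hirr hκ).returnMat_ne_top hz x x
  · rw [h.at_critical]
    intro z hz
    refine hR.returnMat_lazyMat_eq_top (ENNReal.one_lt_inv.2 hρ).le (fun u v => ?_) hκ.1 hκ.2 hz x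
    rw [← green_eq hP.nonneg]
    exact (htr u v).ne

end

end LazyChain

end

theorem theorem1p3 {S : Type*} [Countable S] [Infinite S] (P : S → S → ℝ)
    (hP : LazyChain.IsTransitionProb P) (hirr : LazyChain.IsIrreducible P)
    (hρ : LazyChain.spectralRadius P < 1) (L : Set S) (hfin : L.Finite) (hne : L.Nonempty) :
    (LazyChain.IsRhoTransient P →
      (∃! κc : ℝ, LazyChain.IsCriticalValue P L κc) ∧
      ∀ κc : ℝ, LazyChain.IsCriticalValue P L κc →
        LazyChain.IsCriticallyRhoRecurrent (LazyChain.lazy P L κc) ∧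
        ∀ κ ∈ Set.Ioo κc 1, LazyChain.IsStrictlyRhoRecurrent (LazyChain.lazy P L κ)) ∧
    (LazyChain.IsRhoRecurrent P →
      ∀ κ ∈ Set.Ioo (0 : ℝ) 1,
        LazyChain.IsStrictlyRhoRecurrent (LazyChain.lazy P L κ)) := by
  refine ⟨fun htr => ⟨?_, fun κc hc => ⟨hc.isCriticallyRhoRecurrent hP hirr hρ htr, ?_⟩⟩, ?_⟩
  · obtain ⟨κc, hc⟩ := LazyChain.exists_isCriticalValue hP hirr hρ hfin hne htr
    exact ⟨κc, hc, fun κ hκ => hκ.eq hc⟩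
  · intro κ hκ
    refine LazyChain.isStrictlyRhoRecurrent_lazy_of_lt hP hirr hρ hfin hne
      ⟨hc.mem.1.le.trans hκ.1.le, hκ.2⟩ ?_
    have : LazyChain.spectralRadius (LazyChain.lazy P L κc) <
        LazyChain.spectralRadius (LazyChain.lazy P L κ) := hc.strictMono ⟨le_rfl, hc.mem.2⟩ ⟨hκ.1.le, hκ.2⟩ hκ.1
    rwa [hc.at_critical] at this
  · intro hrec κ hκ
    refine LazyChain.isStrictlyRhoRecurrent_lazy_of_lt hP hirr hρ hfin hne ⟨hκ.1.le, hκ.2⟩ ?_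
    -- The chain P itself is the lazy version with κ = 0, so strict monotonicity starts there.
    have h0 : LazyChain.IsRhoRecurrent (LazyChain.lazy P L 0) := by rwa [LazyChain.lazy_zero]
    have := h0.spectralRadius_lazy_lt hP hirr hρ hfin hne le_rfl hκ.1 hκ.2
    rwa [LazyChain.lazy_zero] at this
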